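/- Let $K\ge 2$ and $[K]=\{1,\dots,K\}$. For each $k\in[K]$ let $\mu^k$ be a $\sigma$-finite measure on a measurable space $\mathcal X^k$ and let $f_0^k,f_1^k$ be two probability densities with respect to $\mu^k$ such that, for $(i,i')\in\{(0,1),(1,0)\}$, $$\int \log\big(f_i^k/f_{i'}^k\big)\,f_i^k\,d\mu^k>0\quad\text{and}\quad \int \big[\log\big(f_i^k/f_{i'}^k\big)\big]^2 f_i^k\,d\mu^k<\infty .$$ For $A\subset[K]$ let $\mathbb P_A$ (with expectation $\mathbb E_A$) be the law of $K$ independent streams $(X_t^k)_{t\ge1}$, the $k$-th being i.i.d. with density $f_1^k$ if $k\in A$ and $f_0^k$ if $k\notin A$. Let $\mathcal F_t$ be the $\sigma$-field generated by $X_s^k$, $s\le t$, $k\in[K]$. A sequential procedure is a pair $(T,D)$ of an $(\mathcal F_t)_{t\ge 1}$-stopping time $T\in\{1,2,\dots\}\cup\{\infty\}$ and an $\mathcal F_T$-measurable random set $D\subset[K]$. For $\alpha,\beta\in(0,1)$ let $\Delta^{\mathrm{fdr}}(\alpha,\beta)$ be the set of sequential procedures $(T,D)$ with $$\max_{A\subset[K]}\mathbb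 E_A\left[\frac{|D\setminus A|}{\max\{|D|,1\}}\right]\le\alpha,\qquad \max_{A\subset[K]}\mathbb E_A\left[\frac{|A\setminus D|}{\max\{|D^c|,1\}}\right]\le\beta ,$$ and let $T_A^{\min}(\Delta^{\mathrm{fdr}}(\alpha,\beta))=\inf\{\mathbb E_A[T]:(T,D)\in\Delta^{\mathrm{fdr}}(\alpha,\beta)\}$. Put $\lambda_t^k=\sum_{s=1}^t\log\frac{f_1^k(X_s^k)}{f_0^k(X_s^k)}$ and, for $a,b>0$, let the Intersection rule $\delta_I(a,b)=(T_I(a,b),D_I(a,b))$ be $$T_I(a,b)=\min\{t\ge1:\lambda_t^k\notin(-a,b)\text{ for all }k\in[K]\},\qquad D_I(a,b)=\{k\in[K]:\lambda^k_{T_I(a,b)}>0\}.$$ Set $a_{\alpha,\beta}=|\log\beta|+\log K$ and $b_{\alpha,\beta}=|\log\alpha|+\log K$. Then the Intersection rule $\{\delta_I(a_{\alpha,\beta},b_{\alpha,\beta})\}$ is second-order asymptotically optimal in $\{\Delta^{\mathrm{fdr}}(\alpha,\beta)\}$ when $\alpha,\beta$ vanish at the same rate. That is, for all $\alpha,\beta\in(0,1)$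 it belongs to $\Delta^{\mathrm{fdr}}(\alpha,\beta)$ and $\mathbb E_A[T_I(a_{\alpha,\beta},b_{\alpha,\beta})]<\infty$ for each $A\subset[K]$; and for every constant $C>0$ and each $A\subset[K]$, $$\limsup\Big(\mathbb E_A[T_I(a_{\alpha,\beta},b_{\alpha,\beta})]-T_A^{\min}\big(\Delta^{\mathrm{fdr}}(\alpha,\beta)\big)\Big)<\infty$$ as $\alpha,\beta\to0$ within $\{(\alpha,\beta)\in(0,1)^2: C^{-1}\alpha\le\beta\le C\alpha\}$. -/

import Mathlib

open Set Filter Topology MeasureTheory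
open scoped ENNReal NNReal

/-- Simple-versus-simple testing problems for `K` streams of observations: stream `k` takes values
in `𝒳 k`, `μ k` is a σ-finite dominating measure, and `f false k`, `f true k` are the probability
densities of one observation of stream `k` under the null and under the alternative. -/
structure StreamModel (K : ℕ) (𝒳 : Fin K → Type*) [∀ k, MeasurableSpace (𝒳 k)] where
  μ : ∀ k, Measure (𝒳 k)
  sigmaFinite : ∀ k, SigmaFinite (μ k)
  f : Bool → ∀ k, 𝒳 k → ℝ≥0
  measurable_f : ∀ i k, Measurable (f i k)
  lintegral_f : ∀ i k, ∫⁻ x, (f i k x : ℝ≥0∞) ∂(μ k) = 1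

/-- Realizations of all streams: `ω k s` is the `(s + 1)`-st observation of stream `k`. -/
abbrev StreamPath {K : ℕ} (𝒳 : Fin K → Type*) : Type _ := ∀ k, ℕ → 𝒳 k

/-- `obsFiltration 𝒳 t` is generated by the first `t` observations of all streams. -/
def obsFiltration {K : ℕ} (𝒳 : Fin K → Type*) [∀ k, MeasurableSpace (𝒳 k)] :
    Filtration ℕ (inferInstance : MeasurableSpace (StreamPath 𝒳)) where
  seq t := ⨆ s : ℕ, ⨆ _ : s < t,
    MeasurableSpace.comap (fun (ω : StreamPath 𝒳) (k : Fin K) => ω k s) MeasurableSpace.pi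
  mono' _ _ h := iSup_mono fun _ => iSup_mono' fun hs => ⟨lt_of_lt_of_le hs h, le_rfl⟩
  le' _ := iSup_le fun s => iSup_le fun _ => Measurable.comap_le <|
    measurable_pi_lambda _ fun k => (measurable_pi_apply s).comp (measurable_pi_apply k)

/-- A rule `(T, D)`: a (possibly infinite) sample size and a set of streams declared signals. -/
abbrev SeqRule {K : ℕ} (𝒳 : Fin K → Type*) : Type _ :=
  (StreamPath 𝒳 → WithTop ℕ) × (StreamPath 𝒳 → Finset (Fin K))

/-- `(T, D)` is a sequential multiple testing procedure: `T ≥ 1` is a stopping time of the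
observation filtration and every event "stream `k` is declared a signal" belongs to the σ-algebra
of events known at time `T`. -/
structure IsSeqProcedure {K : ℕ} {𝒳 : Fin K → Type*} [∀ k, MeasurableSpace (𝒳 k)]
    (δ : SeqRule 𝒳) : Prop where
  isStoppingTime : IsStoppingTime (obsFiltration 𝒳) δ.1
  one_le : ∀ ω, 1 ≤ δ.1 ω
  measurableSet_decision :
    ∀ k, MeasurableSet[isStoppingTime.measurableSpace] {ω | k ∈ δ.2 ω}

namespace StreamModel

variable {K : ℕ} {𝒳 : Fin K → Type*} [∀ k, MeasurableSpace (𝒳 k)]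

/-- Law of one observation of stream `k` under the null (`false`) or the alternative (`true`). -/
noncomputable def marginal (M : StreamModel K 𝒳) (i : Bool) (k : Fin K) : Measure (𝒳 k) :=
  (M.μ k).withDensity fun x => (M.f i k x : ℝ≥0∞)

/-- Joint law of the data when `A` is the set of signals: streams are independent, each stream is
i.i.d., with the alternative density for `k ∈ A` and the null density for `k ∉ A`. -/
noncomputable def law (M : StreamModel K 𝒳) (A : Finset (Fin K)) : Measure (StreamPath 𝒳) :=
  Measure.pi fun k => Measure.infinitePi fun _ : ℕ => M.marginal (decide (k ∈ A)) k

/-- For `i ≠ i'` in `{0, 1}` and every stream, `∫ log (f_i / f_i') f_i dμ > 0` and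
`∫ (log (f_i / f_i'))² f_i dμ < ∞`. The second integral is taken with extended real values, so that
`log (f_i / f_i') = +∞` where `f_i > 0 = f_i'`, and the integrand is `0` where `f_i = 0`. In
particular its finiteness makes the real-valued first integral a genuine, convergent one. -/
def LogLikelihoodCondition (M : StreamModel K 𝒳) : Prop :=
  ∀ (k : Fin K) (i : Bool),
    0 < ∫ x, Real.log ((M.f i k x : ℝ) / (M.f (!i) k x : ℝ)) * (M.f i k x : ℝ) ∂(M.μ k) ∧
    ∫⁻ x, (ENNReal.log ((M.f i k x : ℝ≥0∞) / (M.f (!i) k x : ℝ≥0∞))).abs ^ 2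
      * (M.f i k x : ℝ≥0∞) ∂(M.μ k) < ⊤

/-- Log-likelihood ratio of stream `k` after `t` observations. -/
noncomputable def llr (M : StreamModel K 𝒳) (t : ℕ) (ω : StreamPath 𝒳) (k : Fin K) : ℝ :=
  ∑ s ∈ Finset.range t, Real.log ((M.f true k (ω k s) : ℝ) / (M.f false k (ω k s) : ℝ))

/-- First time `t ≥ 1` at which no log-likelihood ratio lies in `(-a, b)`; `⊤` if there is none. -/
noncomputable def intersectionTime (M : StreamModel K 𝒳) (a b : ℝ) (ω : StreamPath 𝒳) : WithTop ℕ :=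
  hittingAfter M.llr {l : Fin K → ℝ | ∀ k, l k ∉ Ioo (-a) b} 1 ω

/-- The Intersection rule with thresholds `a, b`. The streams with positive log-likelihood ratio at
the stopping time are declared signals. (If sampling never stops, `untopD 0` gives `∅`.) -/
noncomputable def intersectionRule (M : StreamModel K 𝒳) (a b : ℝ) : SeqRule 𝒳 :=
  (M.intersectionTime a b,
    fun ω => Finset.univ.filter fun k => 0 < M.llr ((M.intersectionTime a b ω).untopD 0) ω k)

/-- Expected sample size `E_A[T]`. -/
noncomputable def ess (M : StreamModel K 𝒳) (A : Finset (Fin K)) (δ : SeqRule 𝒳) : ℝ≥0∞ :=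
  ∫⁻ ω, ENat.toENNReal (δ.1 ω) ∂(M.law A)

/-- False discovery rate `E_A[|D \ A| / max(|D|, 1)]`. -/
noncomputable def fdr (M : StreamModel K 𝒳) (A : Finset (Fin K)) (δ : SeqRule 𝒳) : ℝ :=
  ∫ ω, ((δ.2 ω \ A).card : ℝ) / max ((δ.2 ω).card : ℝ) 1 ∂(M.law A)

/-- False non-discovery rate `E_A[|A \ D| / max(|Dᶜ|, 1)]`. -/
noncomputable def fnr (M : StreamModel K 𝒳) (A : Finset (Fin K)) (δ : SeqRule 𝒳) : ℝ :=
  ∫ ω, ((A \ δ.2 ω).card : ℝ) / max (((δ.2 ω)ᶜ).card : ℝ) 1 ∂(M.law A)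

/-- Procedures with false discovery rate at most `θ.1` and false non-discovery rate at most `θ.2`
under every signal set. -/
def fdrClass (M : StreamModel K 𝒳) (θ : ℝ × ℝ) : Set (SeqRule 𝒳) :=
  {δ | IsSeqProcedure δ ∧ (∀ A, M.fdr A δ ≤ θ.1) ∧ (∀ A, M.fnr A δ ≤ θ.2)}

/-- Smallest expected sample size under the signal set `A` over a class of procedures. -/
noncomputable def minESS (M : StreamModel K 𝒳) (A : Finset (Fin K)) (Δ : Set (SeqRule 𝒳)) : ℝ≥0∞ :=
  ⨅ δ ∈ Δ, M.ess A δ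

/-- The family `δ θ`, `θ ∈ (0,1)²`, is second-order asymptotically optimal in the classes `Δ θ` as
`θ → 0` within `Θ`, no prior information on the signal set being available: `δ θ ∈ Δ θ`, and for
every signal set the excess of the expected sample size of `δ θ` over the smallest one has
`limsup < ∞`. The expected sample sizes are required to be finite, so that (both terms being
finite) no difference `∞ - ∞` occurs. -/
def IsSecondOrderOptimal (M : StreamModel K 𝒳) (δ : ℝ × ℝ → SeqRule 𝒳)
    (Δ : ℝ × ℝ → Set (SeqRule 𝒳)) (Θ : Set (ℝ × ℝ)) : Prop :=
  (∀ θ ∈ Ioo (0 : ℝ) 1 ×ˢ Ioo (0 : ℝ) 1, δ θ ∈ Δ θ) ∧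
  ∀ A : Finset (Fin K),
    (∀ θ ∈ Ioo (0 : ℝ) 1 ×ˢ Ioo (0 : ℝ) 1, M.ess A (δ θ) < ⊤) ∧
    limsup (fun θ => (M.ess A (δ θ) : EReal) - (M.minESS A (Δ θ) : EReal)) (𝓝[Θ] 0) < ⊤

end StreamModel

/-- Pairs `(α, β)` of levels in `(0,1)` with `C⁻¹ α ≤ β ≤ C α`. -/
def sameRateLevels (C : ℝ) : Set (ℝ × ℝ) :=
  {θ | θ ∈ Ioo (0 : ℝ) 1 ×ˢ Ioo (0 : ℝ) 1 ∧ C⁻¹ * θ.1 ≤ θ.2 ∧ θ.2 ≤ C * θ.1}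

/-! Optimality is proved pathwise against an arbitrary competitor `(T, D)`, without any lower bound
on expected sample sizes. Call score the log-likelihood ratio of a stream in favour of its true
hypothesis, and let `h` be the larger threshold. Once every score is at least `h`, the Intersection
rule has stopped. If sampling continues after `T`, stream `k` therefore costs about `2 / drift`
times the sum of two terms: the gap from its score at `T` up to `h`, and the worst later fall below
the line of slope `drift / 2`.

The later fall has a finite mean which does not depend on `T`: the future is independent of the past
(`setLIntegral_shortfall`), and a walk with positive mean and finite variance satisfies Kingman's
bound (`integral_drawdown_le`).

The gap is small on average because the competitor must be accurate. The inequality `r x ≤ r² / 2 +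
exp x` replaces it by `exp h * min 1 (exp (-score))`, up to integrable terms. A change of measure
bounds the mean of the minimum by the probabilities of misclassifying `k` under `A` and under `A`
with the status of `k` flipped (`setLIntegral_min_le`). Both are at most `K max(α, β)` in the class,
while `exp h = K / min(α, β)`, so the product stays bounded at equal rates.

Membership in the class is Wald's likelihood ratio bound: a stream is misclassified with probability
at most `α / K` or `β / K`, and each error rate is at most the expected number of errors of its
kind. -/

open ProbabilityTheory

/-! ### Drawdowns of a random walk with positive drift. -/

section RandomWalk

variable {E : Type*}

/-- Largest value of `0, -S₁, …, -Sₙ`, where `S` is the walk with steps `X (x 0), X (x 1), …`. -/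
noncomputable def drawdown (X : E → ℝ) : ℕ → (ℕ → E) → ℝ
  | 0, _ => 0
  | n + 1, x => max 0 (drawdown X n (fun j => x (j + 1)) - X (x 0))

lemma drawdown_nonneg (X : E → ℝ) (n : ℕ) (x : ℕ → E) : 0 ≤ drawdown X n x := by
  cases n
  · exact le_rfl
  · exact le_max_left _ _

lemma drawdown_le_succ (X : E → ℝ) (n : ℕ) (x : ℕ → E) :
    drawdown X n x ≤ drawdown X (n + 1) x := by
  induction n generalizing x with
  | zero => exact le_max_left _ _
  | succ n ih => exact max_le_max le_rfl (sub_le_sub_right (ih _) _)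

lemma drawdown_mono (X : E → ℝ) (x : ℕ → E) : Monotone fun n => drawdown X n x :=
  monotone_nat_of_le_succ fun n => drawdown_le_succ X n x

lemma neg_sum_le_drawdown (X : E → ℝ) (n : ℕ) (x : ℕ → E) :
    -∑ s ∈ Finset.range n, X (x s) ≤ drawdown X n x := by
  induction n generalizing x with
  | zero => simp [drawdown]
  | succ n ih =>
    rw [Finset.sum_range_succ']
    refine le_trans ?_ (le_max_right _ _)
    linarith [ih fun j => x (j + 1)]

/-- Supremum of the negative excursions of the walk with steps `X (x 0), X (x 1), …`. -/
noncomputable def supDrawdown (X : E → ℝ) (x : ℕ → E) : ℝ≥0∞ :=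
  ⨆ n, ENNReal.ofReal (drawdown X n x)

lemma ofReal_neg_sum_le_supDrawdown (X : E → ℝ) (n : ℕ) (x : ℕ → E) :
    ENNReal.ofReal (-∑ s ∈ Finset.range n, X (x s)) ≤ supDrawdown X x :=
  (ENNReal.ofReal_le_ofReal (neg_sum_le_drawdown X n x)).trans
    (le_iSup (fun n => ENNReal.ofReal (drawdown X n x)) n)

variable [MeasurableSpace E]

lemma measurable_drawdown {X : E → ℝ} (hX : Measurable X) (n : ℕ) :
    Measurable (drawdown X n) := by
  induction n with
  | zero => exact measurable_const
  | succ n ih =>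
    have h : Measurable fun x : ℕ → E => drawdown X n (fun j => x (j + 1)) :=
      ih.comp (measurable_pi_lambda _ fun j => measurable_pi_apply _)
    exact measurable_const.max (h.sub (hX.comp (measurable_pi_apply 0)))

lemma measurable_supDrawdown {X : E → ℝ} (hX : Measurable X) : Measurable (supDrawdown X) :=
  .iSup fun n => (measurable_drawdown hX n).ennreal_ofReal

lemma measurePreserving_shift_infinitePi (ν : Measure E) [IsProbabilityMeasure ν] (n : ℕ) :
    MeasurePreserving (fun (x : ℕ → E) (j : ℕ) => x (j + n))
      (Measure.infinitePi fun _ : ℕ => ν) (Measure.infinitePi fun _ : ℕ => ν) where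
  measurable := measurable_pi_lambda _ fun _ => measurable_pi_apply _
  map_eq := Measure.map_infinitePi_infinitePi_of_inj (P := fun _ : ℕ => ν)
    (f := fun j : ℕ => j + n) (add_left_injective n)

lemma indepFun_eval_zero_shift (ν : Measure E) [IsProbabilityMeasure ν] :
    IndepFun (fun x : ℕ → E => x 0) (fun (x : ℕ → E) (j : ℕ) => x (j + 1))
      (Measure.infinitePi fun _ : ℕ => ν) := by
  have h : iIndepFun (fun (i : ℕ) (x : ℕ → E) => x i) (Measure.infinitePi fun _ : ℕ => ν) :=
    iIndepFun_infinitePi (P := fun _ : ℕ => ν) (X := fun _ x => x) (fun _ => measurable_id)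
  have h' := indep_iSup_of_disjoint (fun i => (measurable_pi_apply i).comap_le) h.iIndep
    (S := {0}) (T := {0}ᶜ) disjoint_compl_right
  refine indep_of_indep_of_le_left (indep_of_indep_of_le_right h' ?_) ?_
  · rw [← measurable_iff_comap_le]
    refine @measurable_pi_lambda _ _ _ (_) _ _ fun j => ?_
    refine Measurable.mono (comap_measurable (fun x : ℕ → E => x (j + 1))) ?_ le_rfl
    exact le_iSup₂_of_le (f := fun i (_ : i ∈ ({0}ᶜ : Set ℕ)) =>
      MeasurableSpace.comap (fun x : ℕ → E => x i) _) (j + 1) (by simp) le_rfl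
  · exact le_iSup₂_of_le (f := fun i (_ : i ∈ ({0} : Set ℕ)) =>
      MeasurableSpace.comap (fun x : ℕ → E => x i) _) 0 (by simp) le_rfl

variable {ν : Measure E} [IsProbabilityMeasure ν] {X : E → ℝ}

/-- Finite second moments at each fixed `n`, with no uniform bound, are enough for the cancellation
in Kingman's argument. -/
lemma memLp_drawdown (h2 : MemLp X 2 ν) (n : ℕ) :
    MemLp (drawdown X n) 2 (Measure.infinitePi fun _ : ℕ => ν) := by
  induction n with
  | zero => exact MemLp.zero
  | succ n ih =>
    have h1 := ih.comp_measurePreserving (measurePreserving_shift_infinitePi ν 1)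
    have h0 := h2.comp_measurePreserving (measurePreserving_eval_infinitePi (fun _ : ℕ => ν) 0)
    exact MemLp.sup MemLp.zero (h1.sub h0)

/-- Kingman's bound for the expected overall drawdown of a walk with positive drift. -/
lemma integral_drawdown_le (hX : Measurable X) (h2 : MemLp X 2 ν) (hm : 0 < ∫ x, X x ∂ν) (n : ℕ) :
    ∫ x, drawdown X n x ∂(Measure.infinitePi fun _ : ℕ => ν) ≤
      (∫ x, X x ^ 2 ∂ν) / (2 * ∫ x, X x ∂ν) := by
  set P := Measure.infinitePi fun _ : ℕ => ν
  have hs := measurePreserving_shift_infinitePi ν 1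
  have he := measurePreserving_eval_infinitePi (fun _ : ℕ => ν) 0
  have h1 := (memLp_drawdown h2 n).comp_measurePreserving hs
  have h0 := h2.comp_measurePreserving he
  set D : (ℕ → E) → ℝ := fun x => drawdown X n (fun j => x (j + 1))
  have hD : ∫ x, D x ∂P = ∫ x, drawdown X n x ∂P := by
    have := integral_map (μ := P) hs.measurable.aemeasurable
      (measurable_drawdown hX n).aestronglyMeasurable
    rw [hs.map_eq] at this
    exact this.symm
  have hD2 : ∫ x, D x ^ 2 ∂P = ∫ x, drawdown X n x ^ 2 ∂P := by
    have := integral_map (μ := P) hs.measurable.aemeasurable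
      ((measurable_drawdown hX n).pow_const 2).aestronglyMeasurable
    rw [hs.map_eq] at this
    exact this.symm
  have hX1 : ∫ x, X (x 0) ∂P = ∫ x, X x ∂ν := by
    have := integral_map (μ := P) he.measurable.aemeasurable hX.aestronglyMeasurable
    rw [he.map_eq] at this
    exact this.symm
  have hX2 : ∫ x, X (x 0) ^ 2 ∂P = ∫ x, X x ^ 2 ∂ν := by
    have := integral_map (μ := P) he.measurable.aemeasurable
      (hX.pow_const 2).aestronglyMeasurable
    rw [he.map_eq] at this
    exact this.symm
  have hind : ∫ x, X (x 0) * D x ∂P = (∫ x, X (x 0) ∂P) * ∫ x, D x ∂P :=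
    ((indepFun_eval_zero_shift ν).comp hX (measurable_drawdown hX n)).integral_fun_mul_eq_mul_integral
      h0.aestronglyMeasurable h1.aestronglyMeasurable
  have hint : Integrable (fun x : ℕ → E => X (x 0) * D x) P := h0.integrable_mul h1
  -- `D` is a copy of the drawdown independent of the first step, and the drawdown is at most `max 0
  -- (D - X (x 0))`. After squaring and integrating, the second moments of the drawdown cancel,
  -- which leaves `2 E[X] E[drawdown] ≤ E[X²]`.
  have hstep : ∫ x, drawdown X n x ^ 2 ∂P ≤
      ∫ x, (D x ^ 2 - 2 * (X (x 0) * D x) + X (x 0) ^ 2) ∂P := by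
    refine integral_mono (memLp_drawdown h2 n).integrable_sq
      ((h1.integrable_sq.sub (hint.const_mul 2)).add h0.integrable_sq) fun x => ?_
    have hle : drawdown X n x ≤ max 0 (D x - X (x 0)) := drawdown_le_succ X n x
    have hnn := drawdown_nonneg X n x
    rcases max_cases 0 (D x - X (x 0)) with ⟨h, _⟩ | ⟨h, _⟩ <;> rw [h] at hle <;>
      dsimp only <;> nlinarith [sq_nonneg (D x - X (x 0))]
  rw [integral_add (f := fun x => D x ^ 2 - 2 * (X (x 0) * D x)) (g := fun x => X (x 0) ^ 2)
      (h1.integrable_sq.sub (hint.const_mul 2)) h0.integrable_sq,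
    integral_sub (f := fun x => D x ^ 2) h1.integrable_sq (hint.const_mul 2),
    integral_const_mul] at hstep
  rw [hind, hD, hD2, hX1, hX2] at hstep
  rw [le_div_iff₀ (by positivity)]
  linarith

lemma lintegral_supDrawdown_lt_top (hX : Measurable X) (h2 : MemLp X 2 ν)
    (hm : 0 < ∫ x, X x ∂ν) :
    ∫⁻ x, supDrawdown X x ∂(Measure.infinitePi fun _ : ℕ => ν) < ⊤ := by
  refine lt_of_le_of_lt ?_
    (ENNReal.ofReal_lt_top (r := (∫ x, X x ^ 2 ∂ν) / (2 * ∫ x, X x ∂ν)))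
  unfold supDrawdown
  rw [lintegral_iSup (fun n => (measurable_drawdown hX n).ennreal_ofReal)
    (fun n n' h x => ENNReal.ofReal_le_ofReal (drawdown_mono X x h))]
  refine iSup_le fun n => ?_
  rw [← ofReal_integral_eq_lintegral_ofReal ((memLp_drawdown h2 n).integrable (by norm_num))
    (ae_of_all _ fun x => drawdown_nonneg X n x)]
  exact ENNReal.ofReal_le_ofReal (integral_drawdown_le hX h2 hm n)

end RandomWalk

/-! ### The observation filtration, independence, and change of measure on finitely many
observations. -/

section Observations

variable {K : ℕ} {𝒳 : Fin K → Type*} [∀ k, MeasurableSpace (𝒳 k)]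

/-- Indexing by pairs (stream, time) lets past and future correspond to disjoint index sets of one
independent family. -/
lemma obsFiltration_eq_iSup (n : ℕ) :
    obsFiltration 𝒳 n = ⨆ p ∈ {p : Fin K × ℕ | p.2 < n},
      MeasurableSpace.comap (fun ω : StreamPath 𝒳 => ω p.1 p.2) inferInstance := by
  change (⨆ s : ℕ, ⨆ _ : s < n, MeasurableSpace.comap
    (fun (ω : StreamPath 𝒳) (k : Fin K) => ω k s) (⨆ k, MeasurableSpace.comap _ _)) = _
  simp only [MeasurableSpace.comap_iSup, MeasurableSpace.comap_comp]
  apply le_antisymm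
  · exact iSup₂_le fun s hs => iSup_le fun k => le_iSup₂_of_le
      (f := fun (p : Fin K × ℕ) (_ : p ∈ {p : Fin K × ℕ | p.2 < n}) =>
        MeasurableSpace.comap (fun ω : StreamPath 𝒳 => ω p.1 p.2) inferInstance) (k, s) hs le_rfl
  · exact iSup₂_le fun p hp => le_iSup₂_of_le (f := fun (s : ℕ) (_ : s < n) => ⨆ k : Fin K,
      MeasurableSpace.comap (fun ω : StreamPath 𝒳 => ω k s) inferInstance) p.2 hp
      (le_iSup (fun k : Fin K =>
        MeasurableSpace.comap (fun ω : StreamPath 𝒳 => ω k p.2) inferInstance) p.1)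

lemma measurable_obs {n s : ℕ} (k : Fin K) (hs : s < n) :
    Measurable[obsFiltration 𝒳 n] fun ω : StreamPath 𝒳 => ω k s := by
  rw [obsFiltration_eq_iSup]
  refine Measurable.mono (comap_measurable _) ?_ le_rfl
  exact le_iSup₂_of_le (f := fun (p : Fin K × ℕ) (_ : p ∈ {p : Fin K × ℕ | p.2 < n}) =>
    MeasurableSpace.comap (fun ω : StreamPath 𝒳 => ω p.1 p.2) inferInstance) (k, s) hs le_rfl

lemma obsFiltration_le_comap (n : ℕ) :
    obsFiltration 𝒳 n ≤ MeasurableSpace.comap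
      (fun (ω : StreamPath 𝒳) (p : Fin K × Fin n) => ω p.1 p.2) inferInstance := by
  rw [obsFiltration_eq_iSup]
  refine iSup₂_le fun p hp => ?_
  rw [← measurable_iff_comap_le]
  exact (measurable_pi_apply (X := fun p : Fin K × Fin n => 𝒳 p.1) (p.1, (⟨p.2, hp⟩ : Fin n))).comp
    (comap_measurable _)

end Observations

namespace StreamModel

variable {K : ℕ} {𝒳 : Fin K → Type*} [∀ k, MeasurableSpace (𝒳 k)] (M : StreamModel K 𝒳)

instance (i : Bool) (k : Fin K) : IsProbabilityMeasure (M.marginal i k) :=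
  ⟨by simp [marginal, M.lintegral_f i k]⟩

instance (A : Finset (Fin K)) : IsProbabilityMeasure (M.law A) := by
  unfold law; infer_instance

lemma iIndepFun_obs (A : Finset (Fin K)) :
    iIndepFun (fun (p : Fin K × ℕ) (ω : StreamPath 𝒳) => ω p.1 p.2) (M.law A) := by
  unfold law
  rw [← Measure.infinitePi_eq_pi]
  exact iIndepFun_uncurry_infinitePi' (Ω := fun k _ => 𝒳 k) (X := fun _ _ x => x)
    (fun (k : Fin K) (_ : ℕ) => M.marginal (decide (k ∈ A)) k) fun _ _ => measurable_id

lemma measurePreserving_stream (A : Finset (Fin K)) (k : Fin K) :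
    MeasurePreserving (fun ω : StreamPath 𝒳 => ω k) (M.law A)
      (Measure.infinitePi fun _ : ℕ => M.marginal (decide (k ∈ A)) k) :=
  measurePreserving_eval _ k

lemma measurePreserving_obs (A : Finset (Fin K)) (k : Fin K) (s : ℕ) :
    MeasurePreserving (fun ω : StreamPath 𝒳 => ω k s) (M.law A)
      (M.marginal (decide (k ∈ A)) k) :=
  (measurePreserving_eval_infinitePi (fun _ : ℕ => M.marginal (decide (k ∈ A)) k) s).comp
    (M.measurePreserving_stream A k)

/-- The future observations of a stream are independent of the past. -/
lemma indep_obsFiltration_shift (A : Finset (Fin K)) (k : Fin K) (n : ℕ) :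
    Indep (obsFiltration 𝒳 n)
      (MeasurableSpace.comap (fun (ω : StreamPath 𝒳) (j : ℕ) => ω k (j + n)) inferInstance)
      (M.law A) := by
  have h := indep_iSup_of_disjoint
    (fun p : Fin K × ℕ => Measurable.comap_le (f := fun ω : StreamPath 𝒳 => ω p.1 p.2)
      ((measurable_pi_apply p.2).comp (measurable_pi_apply p.1))) (M.iIndepFun_obs A).iIndep
    (S := {p | p.2 < n}) (T := {p | p.2 < n}ᶜ) disjoint_compl_right
  rw [← obsFiltration_eq_iSup] at h
  refine indep_of_indep_of_le_right h ?_
  rw [← measurable_iff_comap_le]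
  refine @measurable_pi_lambda _ _ _ (_) _ _ fun j => ?_
  refine Measurable.mono (comap_measurable (fun ω : StreamPath 𝒳 => ω k (j + n))) ?_ le_rfl
  exact le_iSup₂_of_le (f := fun (p : Fin K × ℕ) (_ : p ∈ {p : Fin K × ℕ | p.2 < n}ᶜ) =>
    MeasurableSpace.comap (fun ω : StreamPath 𝒳 => ω p.1 p.2) inferInstance) (k, j + n)
    (by simp) le_rfl

lemma measurePreserving_shift (A : Finset (Fin K)) (k : Fin K) (n : ℕ) :
    MeasurePreserving (fun (ω : StreamPath 𝒳) (j : ℕ) => ω k (j + n)) (M.law A)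
      (Measure.infinitePi fun _ : ℕ => M.marginal (decide (k ∈ A)) k) :=
  (measurePreserving_shift_infinitePi _ n).comp (M.measurePreserving_stream A k)

/-- It suffices to compare the measures on rectangles. There the density times the indicator is a
product over single observations, and independence factorises its integral. -/
lemma map_withDensity_prod_obs {A B : Finset (Fin K)} {G : ∀ k, 𝒳 k → ℝ≥0∞}
    (hG : ∀ k, Measurable (G k))
    (h : ∀ k, M.marginal (decide (k ∈ B)) k = (M.marginal (decide (k ∈ A)) k).withDensity (G k))
    (n : ℕ) :
    ((M.law A).withDensity fun ω => ∏ p : Fin K × Fin n, G p.1 (ω p.1 p.2)).map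
      (fun (ω : StreamPath 𝒳) (p : Fin K × Fin n) => ω p.1 p.2) =
      Measure.pi fun p : Fin K × Fin n => M.marginal (decide (p.1 ∈ B)) p.1 := by
  have hobs : ∀ (k : Fin K) (s : ℕ), Measurable fun ω : StreamPath 𝒳 => ω k s := fun k s =>
    (measurable_pi_apply s).comp (measurable_pi_apply k)
  refine (Measure.pi_eq fun t ht => ?_).symm
  have hpre : MeasurableSet ((fun (ω : StreamPath 𝒳) (p : Fin K × Fin n) => ω p.1 p.2) ⁻¹'
      univ.pi t) :=
    measurableSet_preimage (measurable_pi_lambda _ fun p => hobs _ _) (MeasurableSet.univ_pi ht)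
  rw [Measure.map_apply (measurable_pi_lambda _ fun p => hobs _ _) (MeasurableSet.univ_pi ht),
    withDensity_apply _ hpre, ← lintegral_indicator hpre]
  have hind := (M.iIndepFun_obs A).precomp (g := fun p : Fin K × Fin n => (p.1, (p.2 : ℕ)))
    (fun p q hpq => by
      simp only [Prod.mk.injEq, Fin.val_inj] at hpq
      exact Prod.ext hpq.1 hpq.2)
  have hmeas : ∀ p : Fin K × Fin n, Measurable ((t p).indicator (G p.1)) := fun p =>
    (hG p.1).indicator (ht p)
  have key := lintegral_prod_eq_prod_lintegral_of_indepFun Finset.univ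
    (fun (p : Fin K × Fin n) (ω : StreamPath 𝒳) => (t p).indicator (G p.1) (ω p.1 p.2))
    (hind.comp (fun p => (t p).indicator (G p.1)) hmeas)
    (fun p => (hmeas p).comp (hobs _ _))
  calc _ = ∫⁻ ω, ∏ p : Fin K × Fin n, (t p).indicator (G p.1) (ω p.1 p.2) ∂(M.law A) := by
        refine lintegral_congr fun ω => ?_
        by_cases hω : ∀ p : Fin K × Fin n, ω p.1 p.2 ∈ t p
        · rw [indicator_of_mem (by simpa [Set.mem_pi] using hω)]
          exact Finset.prod_congr rfl fun p _ => (indicator_of_mem (hω p) _).symm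
        · rw [indicator_of_notMem (by simpa [Set.mem_pi] using hω)]
          push Not at hω
          obtain ⟨p, hp⟩ := hω
          exact (Finset.prod_eq_zero (Finset.mem_univ p) (indicator_of_notMem hp _)).symm
    _ = _ := key
    _ = _ := by
        refine Finset.prod_congr rfl fun p _ => ?_
        rw [h p.1, withDensity_apply _ (ht p), ← lintegral_indicator (ht p)]
        exact (M.measurePreserving_obs A p.1 p.2).lintegral_comp (hmeas p)

/-- Change of measure on the first `n` observations. -/
lemma law_apply_eq_setLIntegral {A B : Finset (Fin K)} {G : ∀ k, 𝒳 k → ℝ≥0∞}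
    (hG : ∀ k, Measurable (G k))
    (h : ∀ k, M.marginal (decide (k ∈ B)) k = (M.marginal (decide (k ∈ A)) k).withDensity (G k))
    {n : ℕ} {S : Set (StreamPath 𝒳)} (hS : MeasurableSet[obsFiltration 𝒳 n] S) :
    M.law B S = ∫⁻ ω in S, ∏ p : Fin K × Fin n, G p.1 (ω p.1 p.2) ∂(M.law A) := by
  have hr : Measurable fun (ω : StreamPath 𝒳) (p : Fin K × Fin n) => ω p.1 p.2 :=
    measurable_pi_lambda _ fun p => (measurable_pi_apply _).comp (measurable_pi_apply p.1)
  obtain ⟨S', hS', rfl⟩ := obsFiltration_le_comap n _ hS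
  -- The trivial density, from `B` to itself, identifies the law of the finite array under `B`.
  have hB := M.map_withDensity_prod_obs (A := B) (G := fun _ _ => 1) (fun _ => measurable_const)
    (fun k => by rw [← Pi.one_def, withDensity_one]) n
  simp only [Finset.prod_const_one] at hB
  rw [← Pi.one_def, withDensity_one] at hB
  rw [← withDensity_apply _ (hr hS'), ← Measure.map_apply hr hS', ← Measure.map_apply hr hS', hB,
    M.map_withDensity_prod_obs hG h]

end StreamModel

/-! ### Consequences of the log-likelihood condition; likelihood ratio of two signal sets differing
in one stream. -/

namespace StreamModel

variable {K : ℕ} {𝒳 : Fin K → Type*} [∀ k, MeasurableSpace (𝒳 k)] (M : StreamModel K 𝒳)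

/-- Log-likelihood ratio, in favour of hypothesis `i`, of one observation of stream `k`. -/
noncomputable def logRatio (i : Bool) (k : Fin K) (x : 𝒳 k) : ℝ :=
  Real.log ((M.f i k x : ℝ) / (M.f (!i) k x : ℝ))

lemma measurable_logRatio (i : Bool) (k : Fin K) : Measurable (M.logRatio i k) :=
  Real.measurable_log.comp ((M.measurable_f i k).coe_nnreal_real.div
    (M.measurable_f (!i) k).coe_nnreal_real)

lemma logRatio_not (i : Bool) (k : Fin K) (x : 𝒳 k) : M.logRatio (!i) k x = -M.logRatio i k x := by
  rw [logRatio, logRatio, Bool.not_not, ← Real.log_inv, inv_div]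

variable {M}

/-- On the exceptional set the extended squared logarithm is weighted to `⊤`, so finiteness of the
integral forces this set to be null. Applied to both values of `i`, this gives mutual absolute
continuity. -/
lemma LogLikelihoodCondition.ae_eq_zero (hM : M.LogLikelihoodCondition) (i : Bool) (k : Fin K) :
    ∀ᵐ x ∂M.μ k, M.f (!i) k x = 0 → M.f i k x = 0 := by
  have hN : MeasurableSet {x | M.f (!i) k x = 0 ∧ M.f i k x ≠ 0} :=
    (M.measurable_f (!i) k (measurableSet_singleton 0)).inter
      (M.measurable_f i k (measurableSet_singleton 0)).compl
  have hle : ⊤ * M.μ k {x | M.f (!i) k x = 0 ∧ M.f i k x ≠ 0} < ⊤ := by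
    rw [← lintegral_indicator_const hN]
    refine lt_of_le_of_lt (lintegral_mono fun x => ?_) (hM k i).2
    by_cases hx : M.f (!i) k x = 0 ∧ M.f i k x ≠ 0
    · simp [hx.1, hx.2, ENNReal.div_zero]
    · rw [indicator_of_notMem (by exact hx)]
      exact zero_le
  have h0 : M.μ k {x | M.f (!i) k x = 0 ∧ M.f i k x ≠ 0} = 0 := by
    by_contra hne
    rw [ENNReal.top_mul hne] at hle
    exact lt_irrefl _ hle
  rw [ae_iff]
  convert! h0 using 3
  simp

lemma LogLikelihoodCondition.marginal_not (hM : M.LogLikelihoodCondition) (i : Bool)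
    (k : Fin K) : M.marginal (!i) k =
      (M.marginal i k).withDensity fun x => ENNReal.ofReal (Real.exp (-M.logRatio i k x)) := by
  have hg : Measurable fun x => ENNReal.ofReal (Real.exp (-M.logRatio i k x)) :=
    (M.measurable_logRatio i k).neg.exp.ennreal_ofReal
  unfold marginal
  rw [← withDensity_mul _ (M.measurable_f i k).coe_nnreal_ennreal hg]
  refine withDensity_congr_ae ?_
  have h1 := hM.ae_eq_zero i k
  have h2 := hM.ae_eq_zero (!i) k
  rw [Bool.not_not] at h2
  filter_upwards [h1, h2] with x h1 h2
  rw [Pi.mul_apply, logRatio]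
  by_cases h : M.f i k x = 0
  · simp [h, h2 h]
  · have h' : M.f (!i) k x ≠ 0 := fun h' => h (h1 h')
    have hp : (0 : ℝ) < M.f i k x := NNReal.coe_pos.2 (pos_iff_ne_zero.2 h)
    have hp' : (0 : ℝ) < M.f (!i) k x := NNReal.coe_pos.2 (pos_iff_ne_zero.2 h')
    rw [← Real.log_inv, inv_div, Real.exp_log (by positivity), ← ENNReal.ofReal_coe_nnreal,
      ← ENNReal.ofReal_coe_nnreal, ← ENNReal.ofReal_mul hp.le, mul_div_cancel₀ _ hp.ne']

lemma LogLikelihoodCondition.memLp_logRatio (hM : M.LogLikelihoodCondition) (i : Bool)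
    (k : Fin K) : MemLp (M.logRatio i k) 2 (M.marginal i k) := by
  refine ⟨(M.measurable_logRatio i k).aestronglyMeasurable, ?_⟩
  rw [eLpNorm_lt_top_iff_lintegral_rpow_enorm_lt_top two_ne_zero ENNReal.ofNat_ne_top]
  unfold marginal
  rw [lintegral_withDensity_eq_lintegral_mul _ (M.measurable_f i k).coe_nnreal_ennreal
    ((M.measurable_logRatio i k).enorm.pow_const _)]
  refine lt_of_le_of_lt (lintegral_mono fun x => ?_) (hM k i).2
  rw [Pi.mul_apply, mul_comm]
  by_cases h : M.f i k x = 0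
  · simp [h]
  by_cases h' : M.f (!i) k x = 0
  -- Here the extended integrand is `⊤`, so the bound holds whatever value the real logarithm takes.
  · simp [h, h', ENNReal.div_zero]
  refine mul_le_mul_left (le_of_eq ?_) _
  have hr : M.f i k x / M.f (!i) k x ≠ 0 := div_ne_zero h h'
  rw [← ENNReal.coe_div h', ENNReal.log_of_nnreal hr, EReal.abs_def, ENNReal.toReal_ofNat,
    ENNReal.rpow_ofNat, logRatio, NNReal.coe_div, Real.enorm_eq_ofReal_abs]

lemma LogLikelihoodCondition.integral_logRatio_pos (hM : M.LogLikelihoodCondition) (i : Bool)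
    (k : Fin K) : 0 < ∫ x, M.logRatio i k x ∂(M.marginal i k) := by
  unfold marginal
  rw [integral_withDensity_eq_integral_smul (M.measurable_f i k)]
  refine (hM k i).1.trans_eq (integral_congr_ae (ae_of_all _ fun x => ?_))
  simp only [NNReal.smul_def, smul_eq_mul, logRatio]
  ring

variable (M)

/-- Log-likelihood ratio of stream `k` after `t` observations, in favour of the hypothesis which is
true under the signal set `A`. -/
noncomputable def score (A : Finset (Fin K)) (k : Fin K) (t : ℕ) (ω : StreamPath 𝒳) : ℝ :=
  ∑ s ∈ Finset.range t, M.logRatio (decide (k ∈ A)) k (ω k s)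

lemma score_of_mem {A : Finset (Fin K)} {k : Fin K} (hk : k ∈ A) (t : ℕ) (ω : StreamPath 𝒳) :
    M.score A k t ω = M.llr t ω k := by
  simp [score, hk, logRatio, llr]

lemma score_of_notMem {A : Finset (Fin K)} {k : Fin K} (hk : k ∉ A) (t : ℕ) (ω : StreamPath 𝒳) :
    M.score A k t ω = -M.llr t ω k := by
  simp only [score, hk, decide_false, llr, ← Finset.sum_neg_distrib]
  exact Finset.sum_congr rfl fun s _ => M.logRatio_not true k _

lemma measurable_score (A : Finset (Fin K)) (k : Fin K) (t : ℕ) :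
    Measurable[obsFiltration 𝒳 t] (M.score A k t) := by
  unfold score
  exact Finset.measurable_fun_sum _ fun s hs =>
    (M.measurable_logRatio _ k).comp (measurable_obs k (Finset.mem_range.1 hs))

lemma measurable_llr (t : ℕ) : Measurable[obsFiltration 𝒳 t] (M.llr t) := by
  refine @measurable_pi_lambda _ _ _ (_) _ _ fun k => ?_
  have h : (fun ω => M.llr t ω k) = M.score Finset.univ k t :=
    funext fun ω => (M.score_of_mem (Finset.mem_univ k) t ω).symm
  rw [h]
  exact M.measurable_score _ k t

variable {M}

/-- Changing the status of stream `k` in the signal set changes the law of the first `n`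
observations by the likelihood ratio of stream `k`. -/
lemma LogLikelihoodCondition.law_symmDiff_apply (hM : M.LogLikelihoodCondition)
    (A : Finset (Fin K)) (k : Fin K) {n : ℕ} {S : Set (StreamPath 𝒳)}
    (hS : MeasurableSet[obsFiltration 𝒳 n] S) :
    M.law (symmDiff A {k}) S =
      ∫⁻ ω in S, ENNReal.ofReal (Real.exp (-M.score A k n ω)) ∂(M.law A) := by
  have hmeas : Measurable fun x => ENNReal.ofReal (Real.exp (-M.logRatio (decide (k ∈ A)) k x)) :=
    (M.measurable_logRatio _ k).neg.exp.ennreal_ofReal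
  -- All streams other than `k` keep their law, hence the density `1`.
  set G : ∀ j, 𝒳 j → ℝ≥0∞ := Function.update (fun _ _ => 1) k
    fun x => ENNReal.ofReal (Real.exp (-M.logRatio (decide (k ∈ A)) k x)) with hGdef
  have hGk : G k = fun x => ENNReal.ofReal (Real.exp (-M.logRatio (decide (k ∈ A)) k x)) :=
    Function.update_self ..
  have hGj : ∀ j, j ≠ k → G j = fun _ => 1 := fun j hj => Function.update_of_ne hj ..
  have hG : ∀ j, Measurable (G j) := fun j => by
    by_cases hj : j = k
    · subst hj; rwa [hGk]
    · rw [hGj j hj]; exact measurable_const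
  rw [M.law_apply_eq_setLIntegral (A := A) hG (fun j => ?_) hS]
  · refine lintegral_congr fun ω => ?_
    rw [Fintype.prod_prod_type, Finset.prod_eq_single k
      (fun j _ hj => by simp [hGj j hj]) (by simp)]
    simp only [hGk]
    rw [Fin.prod_univ_eq_prod_range (fun s => ENNReal.ofReal
      (Real.exp (-M.logRatio (decide (k ∈ A)) k (ω k s)))),
      ← ENNReal.ofReal_prod_of_nonneg fun s _ => (Real.exp_pos _).le, ← Real.exp_sum,
      Finset.sum_neg_distrib, score]
  · by_cases hj : j = k
    · subst hj
      rw [hGk, ← hM.marginal_not]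
      congr 1
      by_cases hjA : j ∈ A <;> simp [Finset.mem_symmDiff, hjA]
    · rw [hGj j hj, ← Pi.one_def, withDensity_one]
      congr 1
      simp [Finset.mem_symmDiff, hj]

end StreamModel

/-! ### Misclassification events, error rates, and Wald's bound for the Intersection rule. -/

section Misclassification

variable {K : ℕ} {𝒳 : Fin K → Type*}

/-- The event that stream `k` is misclassified when `A` is the set of signals. -/
def misclassified (A : Finset (Fin K)) (k : Fin K) (δ : SeqRule 𝒳) : Set (StreamPath 𝒳) :=
  {ω | ¬(k ∈ δ.2 ω ↔ k ∈ A)}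

/-- Thus every procedure is a test of `A` against `A` with `k` flipped, an error under one being a
correct decision under the other. -/
lemma misclassified_symmDiff (A : Finset (Fin K)) (k : Fin K) (δ : SeqRule 𝒳) :
    misclassified (symmDiff A {k}) k δ = (misclassified A k δ)ᶜ := by
  ext ω
  by_cases hk : k ∈ A <;> simp [misclassified, Finset.mem_symmDiff, hk]

end Misclassification

section Procedures

variable {K : ℕ} {𝒳 : Fin K → Type*} [∀ k, MeasurableSpace (𝒳 k)] {δ : SeqRule 𝒳}

lemma IsSeqProcedure.measurable_decision (hδ : IsSeqProcedure δ) (g : Finset (Fin K) → ℝ) :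
    Measurable fun ω => g (δ.2 ω) := by
  let _ : MeasurableSpace (Finset (Fin K)) := ⊤
  have hmem : ∀ k, MeasurableSet {ω | k ∈ δ.2 ω} := fun k =>
    hδ.isStoppingTime.measurableSpace_le _ (hδ.measurableSet_decision k)
  have hD : Measurable δ.2 := by
    refine measurable_to_countable' fun S => ?_
    have : δ.2 ⁻¹' {S} = ⋂ k, {ω | k ∈ δ.2 ω ↔ k ∈ S} := by
      ext ω
      simp [Finset.ext_iff]
    rw [this]
    refine MeasurableSet.iInter fun k => ?_
    by_cases hk : k ∈ S
    · simpa [hk] using hmem k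
    · convert! (hmem k).compl using 1
      ext ω
      simp [hk]
  exact (measurable_from_top (f := g)).comp hD

lemma IsSeqProcedure.integrable_decision (hδ : IsSeqProcedure δ) (g : Finset (Fin K) → ℝ)
    (P : Measure (StreamPath 𝒳)) [IsFiniteMeasure P] : Integrable (fun ω => g (δ.2 ω)) P :=
  Integrable.of_bound (hδ.measurable_decision g).aestronglyMeasurable (∑ S, ‖g S‖)
    (ae_of_all _ fun ω => Finset.single_le_sum (f := fun S => ‖g S‖) (fun _ _ => norm_nonneg _)
      (Finset.mem_univ (δ.2 ω)))

lemma IsSeqProcedure.measurableSet_misclassified (hδ : IsSeqProcedure δ) (A : Finset (Fin K))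
    (k : Fin K) : MeasurableSet[hδ.isStoppingTime.measurableSpace] (misclassified A k δ) := by
  by_cases hk : k ∈ A
  · convert! (hδ.measurableSet_decision k).compl using 1
    ext ω
    simp [misclassified, hk]
  · convert! hδ.measurableSet_decision k using 1
    ext ω
    simp [misclassified, hk]

lemma IsSeqProcedure.measurableSet_misclassified_inter (hδ : IsSeqProcedure δ)
    (A : Finset (Fin K)) (k : Fin K) (n : ℕ) :
    MeasurableSet[obsFiltration 𝒳 n] (misclassified A k δ ∩ {ω | δ.1 ω = n}) :=
  (hδ.isStoppingTime.measurableSet_inter_eq_iff _ n).1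
    ((hδ.measurableSet_misclassified A k).inter (hδ.isStoppingTime.measurableSet_eq' n))

end Procedures

namespace StreamModel

variable {K : ℕ} {𝒳 : Fin K → Type*} [∀ k, MeasurableSpace (𝒳 k)] (M : StreamModel K 𝒳)
  {δ : SeqRule 𝒳}

lemma one_le_mul_div_card {S U : Finset (Fin K)} {k : Fin K} (hk : k ∈ S) :
    (1 : ℝ) ≤ K * ((S.card : ℝ) / max (U.card : ℝ) 1) := by
  have hK : (1 : ℝ) ≤ K := by exact_mod_cast Fin.pos_iff_nonempty.2 ⟨k⟩
  have hU : max (U.card : ℝ) 1 ≤ K :=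
    max_le (by exact_mod_cast (Finset.card_le_univ U).trans_eq (Fintype.card_fin K)) hK
  have hS : (1 : ℝ) ≤ S.card := by exact_mod_cast Finset.card_pos.2 ⟨k, hk⟩
  rw [← mul_div_assoc, le_div_iff₀ (by positivity)]
  nlinarith

/-- A single error makes the relevant false proportion at least `1 / K`, since its denominator never
exceeds `K`; Markov's inequality concludes. -/
lemma law_misclassified_le {θ : ℝ × ℝ} (hδ : δ ∈ M.fdrClass θ) (A : Finset (Fin K))
    (k : Fin K) :
    M.law A (misclassified A k δ) ≤ ENNReal.ofReal (K * max θ.1 θ.2) := by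
  obtain ⟨hδ, hfdr, hfnr⟩ := hδ
  have hmeas : MeasurableSet (misclassified A k δ) :=
    hδ.isStoppingTime.measurableSpace_le _ (hδ.measurableSet_misclassified A k)
  have key : ∀ g : Finset (Fin K) → ℝ, (∀ S, 0 ≤ g S) →
      (∀ S, ¬(k ∈ S ↔ k ∈ A) → 1 ≤ K * g S) → ∫ ω, g (δ.2 ω) ∂(M.law A) ≤ max θ.1 θ.2 →
      M.law A (misclassified A k δ) ≤ ENNReal.ofReal (K * max θ.1 θ.2) := by
    intro g hg0 hg hle
    rw [← ofReal_measureReal]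
    refine ENNReal.ofReal_le_ofReal ?_
    rw [← integral_indicator_one hmeas]
    calc _ ≤ ∫ ω, K * g (δ.2 ω) ∂(M.law A) := by
          refine integral_mono ((integrable_const 1).indicator hmeas)
            ((hδ.integrable_decision g _).const_mul _) fun ω => ?_
          by_cases hω : ω ∈ misclassified A k δ
          · rw [indicator_of_mem hω]
            exact hg _ hω
          · rw [indicator_of_notMem hω]
            exact mul_nonneg (Nat.cast_nonneg _) (hg0 _)
      _ ≤ _ := by
          rw [integral_const_mul]
          exact mul_le_mul_of_nonneg_left hle (Nat.cast_nonneg _)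
  by_cases hk : k ∈ A
  · refine key (fun S => ((A \ S).card : ℝ) / max ((Sᶜ).card : ℝ) 1) (fun S => by positivity)
      (fun S hS => one_le_mul_div_card (k := k) ?_) ((hfnr A).trans (le_max_right _ _))
    simp only [hk, iff_true] at hS
    exact Finset.mem_sdiff.2 ⟨hk, hS⟩
  · refine key (fun S => ((S \ A).card : ℝ) / max (S.card : ℝ) 1) (fun S => by positivity)
      (fun S hS => one_le_mul_div_card (k := k) ?_) ((hfdr A).trans (le_max_left _ _))
    simp only [hk, iff_false, not_not] at hS
    exact Finset.mem_sdiff.2 ⟨hS, hk⟩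

/-- Dropping the denominator bounds the rate by an expected number of errors. Leaving `S` general
covers false discoveries and false non-discoveries alike. -/
lemma integral_card_div_le (hδ : IsSeqProcedure δ) (A : Finset (Fin K))
    {S U : Finset (Fin K) → Finset (Fin K)} {ε : ℝ} (hε : 0 ≤ ε)
    (hS : ∀ D k, k ∈ S D → ¬(k ∈ D ↔ k ∈ A))
    (h : ∀ D k, k ∈ S D → M.law A (misclassified A k δ) ≤ ENNReal.ofReal ε) :
    ∫ ω, ((S (δ.2 ω)).card : ℝ) / max ((U (δ.2 ω)).card : ℝ) 1 ∂(M.law A) ≤ K * ε := by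
  classical
  -- Only streams that can commit this kind of error are summed, so `h` is used for no other stream.
  set Q : Finset (Fin K) := Finset.univ.filter fun k => ∃ D, k ∈ S D
  have hmeas : ∀ k, MeasurableSet (misclassified A k δ) := fun k =>
    hδ.isStoppingTime.measurableSpace_le _ (hδ.measurableSet_misclassified A k)
  calc _ ≤ ∫ ω, ∑ k ∈ Q, (misclassified A k δ).indicator 1 ω ∂(M.law A) := by
        refine integral_mono (hδ.integrable_decision (fun D => ((S D).card : ℝ) /
          max ((U D).card : ℝ) 1) _) (integrable_finsetSum _ fun k _ =>
            (integrable_const (1 : ℝ)).indicator (hmeas k)) fun ω => ?_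
        refine (div_le_self (Nat.cast_nonneg _) (le_max_right _ _)).trans ?_
        rw [Finset.cast_card]
        refine (Finset.sum_le_sum fun k hk => ?_).trans (Finset.sum_le_sum_of_subset_of_nonneg
          (fun k hk => Finset.mem_filter.2 ⟨Finset.mem_univ k, δ.2 ω, hk⟩)
          fun k _ _ => indicator_nonneg (fun _ _ => zero_le_one) _)
        rw [indicator_of_mem (show ω ∈ misclassified A k δ from hS _ _ hk)]
        exact le_rfl
    _ = ∑ k ∈ Q, (M.law A).real (misclassified A k δ) := by
        rw [integral_finsetSum Q (f := fun k => (misclassified A k δ).indicator 1)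
          fun k _ => (integrable_const (1 : ℝ)).indicator (hmeas k)]
        exact Finset.sum_congr rfl fun k _ => integral_indicator_one (hmeas k)
    _ ≤ ∑ k ∈ Q, ε := by
        refine Finset.sum_le_sum fun k hk => ?_
        obtain ⟨D, hD⟩ := (Finset.mem_filter.1 hk).2
        exact ENNReal.toReal_le_of_le_ofReal hε (h D k hD)
    _ ≤ K * ε := by
        rw [Finset.sum_const, nsmul_eq_mul]
        refine mul_le_mul_of_nonneg_right ?_ hε
        exact_mod_cast (Finset.card_le_univ Q).trans_eq (Fintype.card_fin K)

lemma isStoppingTime_intersectionTime (a b : ℝ) :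
    IsStoppingTime (obsFiltration 𝒳) (M.intersectionTime a b) := by
  have hs : MeasurableSet {l : Fin K → ℝ | ∀ k, l k ∉ Ioo (-a) b} := by
    rw [ofPred_forall]
    exact MeasurableSet.iInter fun k => ((measurable_pi_apply k) measurableSet_Ioo).compl
  exact Adapted.isStoppingTime_hittingAfter (fun t => M.measurable_llr t) hs

lemma isSeqProcedure_intersectionRule (a b : ℝ) : IsSeqProcedure (M.intersectionRule a b) where
  isStoppingTime := M.isStoppingTime_intersectionTime a b
  one_le ω := le_hittingAfter ω
  measurableSet_decision k := by
    have h : {ω | k ∈ (M.intersectionRule a b).2 ω} =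
        ⋃ n : ℕ, {ω | 0 < M.llr n ω k} ∩ {ω | M.intersectionTime a b ω = n} := by
      ext ω
      simp only [intersectionRule, Finset.mem_filter, Finset.mem_univ, true_and, mem_ofPred_eq,
        mem_iUnion, mem_inter_iff]
      cases hT : M.intersectionTime a b ω with
      | top => simp [llr]
      | coe n =>
        have hu : ∀ m : ℕ, (m : WithTop ℕ).untopD 0 = m := fun _ => rfl
        simp [hu]
    rw [h]
    refine MeasurableSet.iUnion fun n => ?_
    have hn := (M.isStoppingTime_intersectionTime a b).measurableSet_eq n
    refine ((M.isStoppingTime_intersectionTime a b).measurableSet_inter_eq_iff _ n).2 (.inter ?_ hn)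
    exact measurableSet_lt measurable_const ((measurable_pi_apply k).comp (M.measurable_llr n))

variable {M}

lemma score_symmDiff (A : Finset (Fin K)) (k : Fin K) (t : ℕ) (ω : StreamPath 𝒳) :
    M.score (symmDiff A {k}) k t ω = -M.score A k t ω := by
  by_cases hk : k ∈ A
  · rw [M.score_of_mem hk, M.score_of_notMem (by simp [Finset.mem_symmDiff, hk])]
  · rw [M.score_of_notMem hk, M.score_of_mem (by simp [Finset.mem_symmDiff, hk]), neg_neg]

/-- Only an inequality, because the event `τ = ⊤` is left out of the sum. -/
lemma tsum_setLIntegral_eq_le {Ω : Type*} [MeasurableSpace Ω] {P : Measure Ω}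
    {τ : Ω → WithTop ℕ} (hτ : ∀ n : ℕ, MeasurableSet {ω | τ ω = n}) (S : Set Ω)
    (hS : MeasurableSet S) (f : Ω → ℝ≥0∞) :
    ∑' n : ℕ, ∫⁻ ω in S ∩ {ω | τ ω = n}, f ω ∂P ≤ ∫⁻ ω in S, f ω ∂P := by
  rw [← lintegral_iUnion (fun n => hS.inter (hτ n))]
  · exact lintegral_mono_set (iUnion_subset fun n => inter_subset_left)
  · intro m n hmn
    refine disjoint_left.2 fun ω h1 h2 => hmn ?_
    exact WithTop.coe_injective (h1.2.symm.trans h2.2)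

lemma llr_notMem_Ioo {a b : ℝ} {ω : StreamPath 𝒳} {n : ℕ} (h : M.intersectionTime a b ω = n)
    (k : Fin K) : M.llr n ω k ∉ Ioo (-a) b := by
  have := hittingAfter_mem_set_of_ne_top (u := M.llr) (n := 1) (ω := ω)
    (s := {l : Fin K → ℝ | ∀ k, l k ∉ Ioo (-a) b}) (by
      change M.intersectionTime a b ω ≠ ⊤
      rw [h]; exact WithTop.coe_ne_top)
  change M.llr (M.intersectionTime a b ω).untopA ω ∈ _ at this
  rw [h] at this
  exact this k

/-- At the stopping time no stream lies between the thresholds, so the wrong sign means that the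
wrong threshold has been crossed. -/
lemma score_le_of_misclassified {a b : ℝ} (ha : 0 < a) (hb : 0 < b) {A : Finset (Fin K)}
    {k : Fin K} {ω : StreamPath 𝒳} {n : ℕ} (h : M.intersectionTime a b ω = n)
    (hω : ω ∈ misclassified A k (M.intersectionRule a b)) :
    M.score A k n ω ≤ -(if k ∈ A then a else b) := by
  have hout := M.llr_notMem_Ioo h k
  simp only [mem_Ioo, not_and, not_lt] at hout
  have hu : (n : WithTop ℕ).untopD 0 = n := rfl
  by_cases hk : k ∈ A
  · simp only [misclassified, intersectionRule, h, hk, Finset.mem_filter, mem_ofPred_eq,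
      Finset.mem_univ, hu, iff_true, true_and, not_lt] at hω
    rw [M.score_of_mem hk, if_pos hk]
    by_contra hlt
    linarith [hout (not_le.1 hlt)]
  · simp only [misclassified, intersectionRule, h, hk, Finset.mem_filter, mem_ofPred_eq,
      Finset.mem_univ, hu, iff_false, true_and, not_not] at hω
    rw [M.score_of_notMem hk, if_neg hk, neg_le_neg_iff]
    exact hout (by linarith)

/-- Bound for the probability that the Intersection rule stops and misclassifies a stream. -/
lemma LogLikelihoodCondition.law_misclassified_inter_le (hM : M.LogLikelihoodCondition) {a b : ℝ}
    (ha : 0 < a) (hb : 0 < b) (A : Finset (Fin K)) (k : Fin K) :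
    M.law A (misclassified A k (M.intersectionRule a b) ∩ {ω | M.intersectionTime a b ω ≠ ⊤}) ≤
      ENNReal.ofReal (Real.exp (-(if k ∈ A then a else b))) := by
  set c := if k ∈ A then a else b
  set E := misclassified A k (M.intersectionRule a b)
  have hδ := M.isSeqProcedure_intersectionRule a b
  have hEn : ∀ n : ℕ, MeasurableSet[obsFiltration 𝒳 n] (E ∩ {ω | M.intersectionTime a b ω = n}) :=
    hδ.measurableSet_misclassified_inter A k
  -- Wald's argument: on the event `E` at time `n`, the density of the law under `A` with respect to
  -- the law under `B` is `exp (score A k n)`, which is at most `exp (-c)`.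
  set B := symmDiff A {k}
  have hBA : symmDiff B {k} = A := symmDiff_symmDiff_cancel_right _ _
  have hsub : E ∩ {ω | M.intersectionTime a b ω ≠ ⊤} ⊆
      ⋃ n : ℕ, E ∩ {ω | M.intersectionTime a b ω = n} := by
    rintro ω ⟨hE, hT⟩
    obtain ⟨n, hn⟩ := WithTop.ne_top_iff_exists.1 hT
    exact mem_iUnion.2 ⟨n, hE, hn.symm⟩
  have hstep : ∀ n : ℕ, M.law A (E ∩ {ω | M.intersectionTime a b ω = n}) ≤
      ∫⁻ ω in univ ∩ {ω | M.intersectionTime a b ω = n},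
        ENNReal.ofReal (Real.exp (-c)) ∂(M.law B) := by
    intro n
    rw [← hBA, hM.law_symmDiff_apply B k (hEn n)]
    refine (setLIntegral_mono measurable_const fun ω hω => ?_).trans
      (lintegral_mono_set (inter_subset_inter_left _ (subset_univ _)))
    refine ENNReal.ofReal_le_ofReal (Real.exp_le_exp.2 ?_)
    rw [score_symmDiff, neg_neg]
    exact M.score_le_of_misclassified ha hb hω.2 hω.1
  calc _ ≤ ∑' n : ℕ, M.law A (E ∩ {ω | M.intersectionTime a b ω = n}) :=
        (measure_mono hsub).trans (measure_iUnion_le _)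
    _ ≤ _ := ENNReal.tsum_le_tsum hstep
    _ ≤ ∫⁻ ω in univ, ENNReal.ofReal (Real.exp (-c)) ∂(M.law B) :=
        tsum_setLIntegral_eq_le (fun n => (obsFiltration 𝒳).le n _
          ((M.isStoppingTime_intersectionTime a b).measurableSet_eq n)) _ MeasurableSet.univ _
    _ = _ := by simp

end StreamModel

/-! ### Comparison of the Intersection rule with an arbitrary procedure. -/

lemma natCast_ceil_le_one_add_ofReal (x : ℝ) (hx : 0 ≤ x) :
    ((⌈x⌉₊ : ℕ) : ℝ≥0∞) ≤ 1 + ENNReal.ofReal x := by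
  rw [← ENNReal.ofReal_natCast, ← ENNReal.ofReal_one, ← ENNReal.ofReal_add zero_le_one hx]
  exact ENNReal.ofReal_le_ofReal (by linarith [Nat.ceil_lt_add_one hx])

/-- From `exp x ≥ 1 + x + x² / 2` and `(r - x)² ≥ 0` comes `r x ≤ r² / 2 + exp x` for `x ≥ 0`. It is
used with `x = h - s` when `s ≥ 0`, and with `x = h` when `s ≤ 0`, where `r (-s)` is kept apart. -/
lemma ofReal_mul_ofReal_sub_le {r h : ℝ} (hr : 0 ≤ r) (hh : 0 ≤ h) (s : ℝ) :
    ENNReal.ofReal r * ENNReal.ofReal (h - s) ≤ ENNReal.ofReal (r ^ 2 / 2) +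
      (ENNReal.ofReal (Real.exp h) * min 1 (ENNReal.ofReal (Real.exp (-s))) +
        ENNReal.ofReal r * ENNReal.ofReal (-s)) := by
  have key : ∀ x : ℝ, 0 ≤ x → r * x ≤ r ^ 2 / 2 + Real.exp x := fun x hx => by
    nlinarith [Real.quadratic_le_exp_of_nonneg hx, sq_nonneg (r - x)]
  rw [← ENNReal.ofReal_one, ← ENNReal.ofReal_min, ← ENNReal.ofReal_mul hr,
    ← ENNReal.ofReal_mul (Real.exp_pos _).le, ← ENNReal.ofReal_mul hr]
  have hmin : 0 ≤ Real.exp h * min 1 (Real.exp (-s)) := by positivity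
  rcases le_total 0 s with hs | hs
  · rw [← add_assoc, ← ENNReal.ofReal_add (by positivity) hmin]
    refine le_add_right (ENNReal.ofReal_le_ofReal ?_)
    rw [min_eq_right (Real.exp_le_one_iff.2 (by linarith)), ← Real.exp_add, ← sub_eq_add_neg]
    rcases le_total 0 (h - s) with hd | hd
    · exact key _ hd
    · exact (mul_nonpos_of_nonneg_of_nonpos hr hd).trans (by positivity)
  · rw [← ENNReal.ofReal_add hmin (mul_nonneg hr (by linarith)),
      ← ENNReal.ofReal_add (by positivity) (add_nonneg hmin (mul_nonneg hr (by linarith)))]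
    refine ENNReal.ofReal_le_ofReal ?_
    rw [min_eq_left (Real.one_le_exp (by linarith)), mul_one]
    nlinarith [key h hh]

namespace StreamModel

variable {K : ℕ} {𝒳 : Fin K → Type*} [∀ k, MeasurableSpace (𝒳 k)] (M : StreamModel K 𝒳)

/-- Mean of the log-likelihood ratio of stream `k` in favour of its true hypothesis. -/
noncomputable def drift (A : Finset (Fin K)) (k : Fin K) : ℝ :=
  ∫ x, M.logRatio (decide (k ∈ A)) k x ∂(M.marginal (decide (k ∈ A)) k)

/-- How far the score of stream `k` falls, after time `n`, below the line of slope `drift / 2`. -/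
noncomputable def shortfall (A : Finset (Fin K)) (k : Fin K) (n : ℕ) (ω : StreamPath 𝒳) : ℝ≥0∞ :=
  supDrawdown (fun x => M.logRatio (decide (k ∈ A)) k x - M.drift A k / 2) fun j => ω k (j + n)

/-- Expectation of the shortfall, which does not depend on the time. -/
noncomputable def meanShortfall (A : Finset (Fin K)) (k : Fin K) : ℝ≥0∞ :=
  ∫⁻ x, supDrawdown (fun x => M.logRatio (decide (k ∈ A)) k x - M.drift A k / 2) x
    ∂(Measure.infinitePi fun _ : ℕ => M.marginal (decide (k ∈ A)) k)

lemma measurable_supDrawdown_logRatio (A : Finset (Fin K)) (k : Fin K) :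
    Measurable (supDrawdown fun x => M.logRatio (decide (k ∈ A)) k x - M.drift A k / 2) :=
  measurable_supDrawdown ((M.measurable_logRatio _ k).sub_const _)

lemma measurable_shortfall (A : Finset (Fin K)) (k : Fin K) (n : ℕ) :
    Measurable (M.shortfall A k n) :=
  (M.measurable_supDrawdown_logRatio A k).comp (M.measurePreserving_shift A k n).measurable

lemma lintegral_shortfall (A : Finset (Fin K)) (k : Fin K) (n : ℕ) :
    ∫⁻ ω, M.shortfall A k n ω ∂(M.law A) = M.meanShortfall A k :=
  (M.measurePreserving_shift A k n).lintegral_comp (M.measurable_supDrawdown_logRatio A k)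

/-- `S` is decided by time `n`, and the shortfall depends only on later observations. With `S` the
event that a stopping time equals `n`, this plays the role of the strong Markov property. -/
lemma setLIntegral_shortfall (A : Finset (Fin K)) (k : Fin K) {n : ℕ} {S : Set (StreamPath 𝒳)}
    (hS : MeasurableSet[obsFiltration 𝒳 n] S) :
    ∫⁻ ω in S, M.shortfall A k n ω ∂(M.law A) = M.law A S * M.meanShortfall A k := by
  have hS' := (obsFiltration 𝒳).le n _ hS
  have h := lintegral_mul_eq_lintegral_mul_lintegral_of_independent_measurableSpace
    ((obsFiltration 𝒳).le n) (M.measurePreserving_shift A k n).measurable.comap_le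
    (M.indep_obsFiltration_shift A k n) (f := S.indicator 1) (g := M.shortfall A k n)
    (Measurable.indicator (@measurable_const _ _ _ (_) 1) hS)
    ((M.measurable_supDrawdown_logRatio A k).comp (comap_measurable _))
  rw [lintegral_indicator_one hS', lintegral_shortfall] at h
  rw [← h, ← lintegral_indicator hS']
  refine lintegral_congr fun ω => ?_
  by_cases hω : ω ∈ S <;> simp [hω]

lemma ofReal_neg_score_add_le (A : Finset (Fin K)) (k : Fin K) (n j : ℕ) (ω : StreamPath 𝒳) :
    ENNReal.ofReal (M.score A k n ω + M.drift A k / 2 * j - M.score A k (j + n) ω) ≤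
      M.shortfall A k n ω := by
  refine le_of_eq_of_le (congrArg _ ?_) (ofReal_neg_sum_le_supDrawdown _ j _)
  have h : M.score A k (j + n) ω = M.score A k n ω +
      ∑ s ∈ Finset.range j, M.logRatio (decide (k ∈ A)) k (ω k (s + n)) := by
    rw [score, add_comm j n, Finset.sum_range_add, score]
    simp only [add_comm n]
  rw [h, Finset.sum_sub_distrib, Finset.sum_const, Finset.card_range, nsmul_eq_mul]
  ring

lemma ofReal_neg_score_le {A : Finset (Fin K)} {k : Fin K} (hd : 0 < M.drift A k) (n : ℕ)
    (ω : StreamPath 𝒳) : ENNReal.ofReal (-M.score A k n ω) ≤ M.shortfall A k 0 ω := by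
  refine le_trans (ENNReal.ofReal_le_ofReal ?_) (M.ofReal_neg_score_add_le A k 0 n ω)
  have h0 : M.score A k 0 ω = 0 := by simp [score]
  have : 0 ≤ M.drift A k / 2 * n := by positivity
  rw [h0, add_zero n]
  linarith

/-- The Intersection rule stops soon after any time `n`, in terms of the scores at time `n` and the
future shortfalls. -/
lemma intersectionTime_le {A : Finset (Fin K)} (hd : ∀ k, 0 < M.drift A k) {a b h : ℝ}
    (ha : a ≤ h) (hb : b ≤ h) {n : ℕ} (hn : 1 ≤ n) (ω : StreamPath 𝒳) :
    ENat.toENNReal (M.intersectionTime a b ω) ≤ n + ∑ k, (1 + ENNReal.ofReal (2 / M.drift A k) *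
      (ENNReal.ofReal (h - M.score A k n ω) + M.shortfall A k n ω)) := by
  have hr : ∀ k, 0 < 2 / M.drift A k := fun k => div_pos two_pos (hd k)
  by_cases htop : ∃ k, M.shortfall A k n ω = ⊤
  · obtain ⟨k, hk⟩ := htop
    have : ∑ k, (1 + ENNReal.ofReal (2 / M.drift A k) *
        (ENNReal.ofReal (h - M.score A k n ω) + M.shortfall A k n ω)) = ⊤ := by
      refine ENNReal.sum_eq_top.2 ⟨k, Finset.mem_univ k, ?_⟩
      rw [hk, add_top, ENNReal.mul_top (ENNReal.ofReal_pos.2 (hr k)).ne', add_top]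
    rw [this, add_top]
    exact le_top
  push Not at htop
  set y : Fin K → ℝ := fun k => 2 / M.drift A k *
    (max (h - M.score A k n ω) 0 + (M.shortfall A k n ω).toReal) with hy
  have hy0 : ∀ k, 0 ≤ y k := fun k => mul_nonneg (hr k).le
    (add_nonneg (le_max_right _ _) ENNReal.toReal_nonneg)
  -- After `⌈y k⌉₊` further observations score `k` stays above `h`. The sum of these delays, rather
  -- than their maximum, serves all streams and is additive under expectation.
  set N : ℕ := ∑ k, ⌈y k⌉₊ with hN
  have hscore : ∀ k, h ≤ M.score A k (N + n) ω := by
    intro k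
    have hyN : y k ≤ N := (Nat.le_ceil _).trans (by
      exact_mod_cast Finset.single_le_sum (f := fun k => ⌈y k⌉₊) (fun _ _ => Nat.zero_le _)
        (Finset.mem_univ k))
    have h1 := ENNReal.ofReal_le_iff_le_toReal (htop k) |>.1
      (M.ofReal_neg_score_add_le A k n N ω)
    have h2 : max (h - M.score A k n ω) 0 + (M.shortfall A k n ω).toReal ≤
        M.drift A k / 2 * N := by
      have := mul_le_mul_of_nonneg_left hyN (half_pos (hd k)).le
      refine le_of_eq_of_le ?_ this
      simp only [hy]
      field_simp [(hd k).ne']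
    linarith [le_max_left (h - M.score A k n ω) 0]
  have hle : M.intersectionTime a b ω ≤ ((N + n : ℕ) : WithTop ℕ) := by
    refine hittingAfter_le_of_mem (i := N + n) (by omega) fun k hk => ?_
    have := hscore k
    by_cases hkA : k ∈ A
    · rw [M.score_of_mem hkA] at this
      exact absurd hk.2 (by linarith)
    · rw [M.score_of_notMem hkA] at this
      exact absurd hk.1 (by linarith)
  calc ENat.toENNReal (M.intersectionTime a b ω) ≤ ENat.toENNReal ((N + n : ℕ) : ℕ∞) :=
        ENat.toENNReal_mono hle
    _ = n + ∑ k, ((⌈y k⌉₊ : ℕ) : ℝ≥0∞) := by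
        rw [ENat.toENNReal_coe, hN]
        push_cast
        rw [add_comm]
    _ ≤ _ := by
        gcongr with k
        refine (natCast_ceil_le_one_add_ofReal _ (hy0 k)).trans (le_of_eq ?_)
        simp only [hy]
        rw [ENNReal.ofReal_mul (hr k).le, ENNReal.ofReal_add (le_max_right _ _)
          ENNReal.toReal_nonneg, ENNReal.ofReal_toReal (htop k), ENNReal.ofReal_max,
          ENNReal.ofReal_zero, max_eq_left zero_le]

/-- A bound, free of the thresholds, for the time the Intersection rule loses at stream `k`. -/
noncomputable def overhead (A : Finset (Fin K)) (k : Fin K) : ℝ≥0∞ :=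
  1 + ENNReal.ofReal ((2 / M.drift A k) ^ 2 / 2) +
    ENNReal.ofReal (2 / M.drift A k) * (M.meanShortfall A k + M.meanShortfall A k)

lemma intersectionTime_le_add {A : Finset (Fin K)} (hd : ∀ k, 0 < M.drift A k) {a b h : ℝ}
    (hh : 0 ≤ h) (ha : a ≤ h) (hb : b ≤ h) {n : ℕ} (hn : 1 ≤ n) (ω : StreamPath 𝒳) :
    ENat.toENNReal (M.intersectionTime a b ω) ≤ n + ∑ k,
      ((1 + ENNReal.ofReal ((2 / M.drift A k) ^ 2 / 2)) + (ENNReal.ofReal (2 / M.drift A k) *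
        (M.shortfall A k 0 ω + M.shortfall A k n ω) +
        ENNReal.ofReal (Real.exp h) * min 1 (ENNReal.ofReal (Real.exp (-M.score A k n ω))))) := by
  refine (M.intersectionTime_le hd ha hb hn ω).trans
    (add_le_add le_rfl (Finset.sum_le_sum fun k _ => ?_))
  have hr : 0 < 2 / M.drift A k := div_pos two_pos (hd k)
  rw [mul_add]
  calc _ ≤ 1 + ((ENNReal.ofReal ((2 / M.drift A k) ^ 2 / 2) +
      (ENNReal.ofReal (Real.exp h) * min 1 (ENNReal.ofReal (Real.exp (-M.score A k n ω))) +
        ENNReal.ofReal (2 / M.drift A k) * M.shortfall A k 0 ω)) +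
        ENNReal.ofReal (2 / M.drift A k) * M.shortfall A k n ω) := by
        gcongr
        refine (ofReal_mul_ofReal_sub_le hr.le hh _).trans ?_
        gcongr
        exact M.ofReal_neg_score_le (hd k) n ω
    _ = _ := by ring

variable {M}

lemma LogLikelihoodCondition.drift_pos (hM : M.LogLikelihoodCondition) (A : Finset (Fin K))
    (k : Fin K) : 0 < M.drift A k :=
  hM.integral_logRatio_pos _ k

/-- Subtracting half the drift leaves a walk with mean `drift / 2 > 0` and finite variance, so
Kingman's bound applies. -/
lemma LogLikelihoodCondition.overhead_lt_top (hM : M.LogLikelihoodCondition)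
    (A : Finset (Fin K)) (k : Fin K) : M.overhead A k < ⊤ := by
  have h2 := hM.memLp_logRatio (decide (k ∈ A)) k
  have hs : M.meanShortfall A k < ⊤ := by
    refine lintegral_supDrawdown_lt_top ((M.measurable_logRatio _ k).sub_const _)
      (h2.sub (memLp_const _)) ?_
    rw [integral_sub (h2.integrable (by norm_num)) (integrable_const _), integral_const,
      probReal_univ, one_smul]
    change 0 < M.drift A k - _
    linarith [hM.drift_pos A k]
  unfold overhead
  finiteness

/-- For a set `S` of paths known at time `n`, the event `E` and its complement have, together, large
probability under the two laws which differ by the status of stream `k`. -/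
lemma LogLikelihoodCondition.setLIntegral_min_le (hM : M.LogLikelihoodCondition)
    (A : Finset (Fin K)) (k : Fin K) {n : ℕ} {S E : Set (StreamPath 𝒳)}
    (hSE : MeasurableSet[obsFiltration 𝒳 n] (Eᶜ ∩ S)) :
    ∫⁻ ω in S, min 1 (ENNReal.ofReal (Real.exp (-M.score A k n ω))) ∂(M.law A) ≤
      M.law A (E ∩ S) + M.law (symmDiff A {k}) (Eᶜ ∩ S) := by
  have hS : S = (E ∩ S) ∪ (Eᶜ ∩ S) := by rw [← union_inter_distrib_right, union_compl_self, univ_inter]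
  calc _ ≤ ∫⁻ ω in E ∩ S, min 1 (ENNReal.ofReal (Real.exp (-M.score A k n ω))) ∂(M.law A) +
        ∫⁻ ω in Eᶜ ∩ S, min 1 (ENNReal.ofReal (Real.exp (-M.score A k n ω))) ∂(M.law A) := by
        conv_lhs => rw [hS]
        exact lintegral_union_le _ _ _
    -- On `E` the minimum is bounded by `1`; off `E` it is bounded by the likelihood ratio, which
    -- moves the integral to the flipped signal set.
    _ ≤ ∫⁻ ω in E ∩ S, 1 ∂(M.law A) +
        ∫⁻ ω in Eᶜ ∩ S, ENNReal.ofReal (Real.exp (-M.score A k n ω)) ∂(M.law A) :=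
        add_le_add (lintegral_mono fun _ => min_le_left _ _)
          (lintegral_mono fun _ => min_le_right _ _)
    _ = _ := by rw [setLIntegral_one, hM.law_symmDiff_apply A k hSE]

lemma law_setOf_eq_top {δ : SeqRule 𝒳} (hδ : IsSeqProcedure δ) {A : Finset (Fin K)}
    (h : M.ess A δ ≠ ⊤) : M.law A {ω | δ.1 ω = ⊤} = 0 := by
  have hmeas : MeasurableSet {ω | δ.1 ω = ⊤} := by
    have : {ω | δ.1 ω = ⊤} = (⋃ n : ℕ, {ω | δ.1 ω = n})ᶜ := by
      ext ω
      simp only [mem_ofPred_eq, mem_compl_iff, mem_iUnion]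
      refine ⟨fun h => by simp [h], fun h => ?_⟩
      by_contra hne
      obtain ⟨n, hn⟩ := WithTop.ne_top_iff_exists.1 hne
      exact h ⟨n, hn.symm⟩
    rw [this]
    exact (MeasurableSet.iUnion fun n =>
      (obsFiltration 𝒳).le n _ (hδ.isStoppingTime.measurableSet_eq n)).compl
  by_contra hne
  refine h (top_le_iff.1 ?_)
  calc ⊤ = ⊤ * M.law A {ω | δ.1 ω = ⊤} := (ENNReal.top_mul hne).symm
    _ = ∫⁻ ω, {ω | δ.1 ω = ⊤}.indicator (fun _ => ⊤) ω ∂(M.law A) :=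
        (lintegral_indicator_const hmeas _).symm
    _ ≤ M.ess A δ := by
        refine lintegral_mono fun ω => ?_
        by_cases hω : δ.1 ω = ⊤
        · rw [hω]; exact le_top
        · rw [indicator_of_notMem (by exact hω)]; exact zero_le

/-- Comparison of the Intersection rule with an arbitrary procedure. -/
theorem LogLikelihoodCondition.ess_intersectionRule_le (hM : M.LogLikelihoodCondition)
    {δ : SeqRule 𝒳} (hδ : IsSeqProcedure δ) (A : Finset (Fin K)) {a b h : ℝ} (hh : 0 ≤ h)
    (ha : a ≤ h) (hb : b ≤ h) :
    M.ess A (M.intersectionRule a b) ≤ M.ess A δ + ∑ k, (M.overhead A k +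
      ENNReal.ofReal (Real.exp h) * (M.law A (misclassified A k δ) +
        M.law (symmDiff A {k}) (misclassified (symmDiff A {k}) k δ))) := by
  set S : ℕ → Set (StreamPath 𝒳) := fun n => {ω | δ.1 ω = n} with hSdef
  have hSn : ∀ n, MeasurableSet[obsFiltration 𝒳 n] (S n) := fun n =>
    hδ.isStoppingTime.measurableSet_eq n
  have hS : ∀ n, MeasurableSet (S n) := fun n => (obsFiltration 𝒳).le n _ (hSn n)
  have htsum : ∀ (P : Measure (StreamPath 𝒳)) (f : StreamPath 𝒳 → ℝ≥0∞),
      ∑' n, ∫⁻ ω in S n, f ω ∂P ≤ ∫⁻ ω, f ω ∂P := fun P f => by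
    simpa using tsum_setLIntegral_eq_le (P := P) hS univ MeasurableSet.univ f
  have htsum' : ∀ (P : Measure (StreamPath 𝒳)) (E : Set (StreamPath 𝒳)), MeasurableSet E →
      ∑' n, P (E ∩ S n) ≤ P E := fun P E hE => by
    simpa using tsum_setLIntegral_eq_le (P := P) hS E hE fun _ => 1
  by_cases htop : M.ess A δ = ⊤
  · rw [htop, top_add]; exact le_top
  -- A finite expected sample size makes the competitor stop almost surely, so the events `S n`
  -- exhaust the space up to a null set.
  have hcover : ∑' n, ∫⁻ ω in S n,
      ENat.toENNReal (M.intersectionTime a b ω) ∂(M.law A) = M.ess A (M.intersectionRule a b) := by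
    rw [← lintegral_iUnion hS fun m n hmn => disjoint_left.2 fun ω h1 h2 =>
      hmn (WithTop.coe_injective (Eq.trans (Eq.symm h1) h2)), ess]
    refine (setLIntegral_congr (t := univ) (eventuallyEq_univ.2 ?_)).trans (setLIntegral_univ _)
    have h0 : ∀ᵐ ω ∂(M.law A), ¬δ.1 ω = ⊤ := by
      rw [ae_iff]
      simpa using law_setOf_eq_top hδ htop
    filter_upwards [h0] with ω hω
    obtain ⟨n, hn⟩ := WithTop.ne_top_iff_exists.1 hω
    exact mem_iUnion.2 ⟨n, hn.symm⟩
  rw [← hcover]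
  set r : Fin K → ℝ≥0∞ := fun k => ENNReal.ofReal (2 / M.drift A k) with hr
  obtain ⟨c, hc⟩ : ∃ c : Fin K → ℝ≥0∞, c = fun k =>
    1 + ENNReal.ofReal ((2 / M.drift A k) ^ 2 / 2) := ⟨_, rfl⟩
  set e : ℝ≥0∞ := ENNReal.ofReal (Real.exp h)
  -- On `S n` the pathwise bound is taken at the competitor's own stopping time `n`; the future
  -- shortfall factors out, and the minimum turns into the competitor's two error probabilities.
  have hstep : ∀ n, ∫⁻ ω in S n, ENat.toENNReal (M.intersectionTime a b ω) ∂(M.law A) ≤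
      ∫⁻ ω in S n, ENat.toENNReal (δ.1 ω) ∂(M.law A) + ∑ k, (∫⁻ ω in S n, c k ∂(M.law A) +
        (r k * (∫⁻ ω in S n, M.shortfall A k 0 ω ∂(M.law A) +
          M.law A (univ ∩ S n) * M.meanShortfall A k) +
        e * (M.law A (misclassified A k δ ∩ S n) +
          M.law (symmDiff A {k}) (misclassified (symmDiff A {k}) k δ ∩ S n)))) := by
    intro n
    have hmin : ∀ k, Measurable fun ω =>
        min 1 (ENNReal.ofReal (Real.exp (-M.score A k n ω))) := fun k =>
      measurable_const.min (((M.measurable_score A k n).mono ((obsFiltration 𝒳).le n)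
        le_rfl).neg.exp.ennreal_ofReal)
    have hsf := fun k j => M.measurable_shortfall A k j
    calc _ ≤ ∫⁻ ω in S n, (ENat.toENNReal (δ.1 ω) + ∑ k, (c k + (r k *
          (M.shortfall A k 0 ω + M.shortfall A k n ω) +
          e * min 1 (ENNReal.ofReal (Real.exp (-M.score A k n ω)))))) ∂(M.law A) := by
          refine setLIntegral_mono' (hS n) fun ω hω => ?_
          have h1 := hδ.one_le ω
          rw [show δ.1 ω = n from hω] at h1 ⊢
          rw [hc]
          exact M.intersectionTime_le_add (hM.drift_pos A) hh ha hb (by exact_mod_cast h1) ω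
      _ = ∫⁻ ω in S n, ENat.toENNReal (δ.1 ω) ∂(M.law A) + ∑ k, (∫⁻ ω in S n, c k ∂(M.law A) +
        (r k * (∫⁻ ω in S n, M.shortfall A k 0 ω ∂(M.law A) +
          ∫⁻ ω in S n, M.shortfall A k n ω ∂(M.law A)) +
        e * ∫⁻ ω in S n, min 1 (ENNReal.ofReal (Real.exp (-M.score A k n ω))) ∂(M.law A))) := by
          rw [lintegral_add_right, lintegral_finsetSum]
          · congr 1
            refine Finset.sum_congr rfl fun k _ => ?_
            rw [lintegral_add_left measurable_const, lintegral_add_right,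
              lintegral_const_mul, lintegral_add_left (hsf k 0), lintegral_const_mul _ (hmin k)]
            · exact (hsf k 0).add (hsf k n)
            · exact (hmin k).const_mul _
          · exact fun k _ => measurable_const.add ((((hsf k 0).add (hsf k n)).const_mul _).add
              ((hmin k).const_mul _))
          · exact Finset.measurable_fun_sum _ fun k _ => measurable_const.add
              ((((hsf k 0).add (hsf k n)).const_mul _).add ((hmin k).const_mul _))
      _ ≤ _ := by
          gcongr with k
          · rw [univ_inter, M.setLIntegral_shortfall A k (hSn n)]
          · have := hM.setLIntegral_min_le A k (n := n) (S := S n) (E := misclassified A k δ)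
              (by
                rw [← misclassified_symmDiff]
                exact hδ.measurableSet_misclassified_inter _ k n)
            rwa [← misclassified_symmDiff] at this
  refine (ENNReal.tsum_le_tsum hstep).trans ?_
  have hmis : ∀ B k, MeasurableSet (misclassified B k δ) := fun B k =>
    hδ.isStoppingTime.measurableSpace_le _ (hδ.measurableSet_misclassified B k)
  rw [ENNReal.tsum_add, Summable.tsum_finsetSum fun _ _ => ENNReal.summable]
  refine add_le_add (htsum _ _) (Finset.sum_le_sum fun k _ => ?_)
  rw [ENNReal.tsum_add, ENNReal.tsum_add, ENNReal.tsum_mul_left, ENNReal.tsum_mul_left,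
    ENNReal.tsum_add, ENNReal.tsum_add, ENNReal.tsum_mul_right, ← add_assoc]
  unfold overhead
  gcongr
  · refine (htsum _ _).trans ?_
    simp [hc]
  · exact (htsum _ _).trans_eq (M.lintegral_shortfall A k 0)
  · refine (mul_le_mul_left (htsum' _ _ MeasurableSet.univ) _).trans ?_
    simp
  · exact htsum' _ _ (hmis _ _)
  · exact htsum' _ _ (hmis _ _)

end StreamModel

/-! ### Finite sample size, error control, and the uniform bound on the excess. -/

namespace StreamModel

variable {K : ℕ} {𝒳 : Fin K → Type*} [∀ k, MeasurableSpace (𝒳 k)] {M : StreamModel K 𝒳}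

lemma LogLikelihoodCondition.ess_intersectionRule_lt_top (hM : M.LogLikelihoodCondition)
    (A : Finset (Fin K)) (a b : ℝ) : M.ess A (M.intersectionRule a b) < ⊤ := by
  -- The comparison holds for procedures with arbitrary error rates, so stopping at time `1` and
  -- declaring nothing already yields finiteness.
  set δ : SeqRule 𝒳 := (fun _ => ((1 : ℕ) : WithTop ℕ), fun _ => ∅)
  have hδ : IsSeqProcedure δ :=
    { isStoppingTime := isStoppingTime_const _ 1
      one_le := fun _ => le_rfl
      measurableSet_decision := fun k => by simp [δ] }
  have hess : M.ess A δ = 1 := by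
    have : ∀ ω, ENat.toENNReal (δ.1 ω) = 1 := fun _ => ENat.toENNReal_one
    simp [ess, this]
  refine (hM.ess_intersectionRule_le hδ A (h := max 0 (max a b)) (le_max_left _ _)
    ((le_max_left _ _).trans (le_max_right _ _))
    ((le_max_right _ _).trans (le_max_right _ _))).trans_lt ?_
  rw [hess]
  refine ENNReal.add_lt_top.2 ⟨ENNReal.one_lt_top, ENNReal.sum_lt_top.2 fun k _ => ?_⟩
  have := (hM.overhead_lt_top A k).ne
  finiteness

/-- Sampling ends almost surely, so Wald's bound holds without the restriction to finite stopping
times. -/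
lemma LogLikelihoodCondition.law_misclassified_intersectionRule_le
    (hM : M.LogLikelihoodCondition) {a b : ℝ} (ha : 0 < a) (hb : 0 < b) (A : Finset (Fin K))
    (k : Fin K) : M.law A (misclassified A k (M.intersectionRule a b)) ≤
      ENNReal.ofReal (Real.exp (-(if k ∈ A then a else b))) := by
  refine le_trans ?_ (hM.law_misclassified_inter_le ha hb A k)
  refine (measure_le_inter_add_sdiff _ _ {ω | M.intersectionTime a b ω ≠ ⊤}).trans ?_
  have h0 : M.law A (misclassified A k (M.intersectionRule a b) \
      {ω | M.intersectionTime a b ω ≠ ⊤}) = 0 :=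
    measure_mono_null (fun ω hω => not_not.1 hω.2)
      (law_setOf_eq_top (M.isSeqProcedure_intersectionRule a b)
        (hM.ess_intersectionRule_lt_top A a b).ne)
  rw [h0, add_zero]

lemma mul_exp_neg_abs_log_add_log {n x : ℝ} (hn : 0 < n) (hx : 0 < x) (hx1 : x < 1) :
    n * Real.exp (-(|Real.log x| + Real.log n)) = x := by
  rw [abs_of_neg (Real.log_neg hx hx1), neg_add, neg_neg, Real.exp_add, Real.exp_log hx,
    Real.exp_neg, Real.exp_log hn]
  field_simp

/-- The Intersection rule controls the false discovery and the false non-discovery rates. -/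
theorem LogLikelihoodCondition.intersectionRule_mem_fdrClass (hM : M.LogLikelihoodCondition)
    (hK : 0 < K) {θ : ℝ × ℝ} (hθ : θ ∈ Ioo (0 : ℝ) 1 ×ˢ Ioo (0 : ℝ) 1) :
    M.intersectionRule (|Real.log θ.2| + Real.log K) (|Real.log θ.1| + Real.log K) ∈
      M.fdrClass θ := by
  obtain ⟨⟨hα0, hα1⟩, hβ0, hβ1⟩ := hθ
  have hK0 : (0 : ℝ) < K := by exact_mod_cast hK
  have hlogK : 0 ≤ Real.log K := Real.log_natCast_nonneg K
  set a := |Real.log θ.2| + Real.log K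
  set b := |Real.log θ.1| + Real.log K
  have ha : 0 < a := add_pos_of_pos_of_nonneg (abs_pos.2 (Real.log_neg hβ0 hβ1).ne) hlogK
  have hb : 0 < b := add_pos_of_pos_of_nonneg (abs_pos.2 (Real.log_neg hα0 hα1).ne) hlogK
  have hδ := M.isSeqProcedure_intersectionRule a b
  refine ⟨hδ, fun A => ?_, fun A => ?_⟩
  · rw [← mul_exp_neg_abs_log_add_log hK0 hα0 hα1]
    refine M.integral_card_div_le hδ A (S := fun D => D \ A) (U := fun D => D)
      (Real.exp_pos _).le (fun D k hk => ?_) fun D k hk => ?_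
    · simp [(Finset.mem_sdiff.1 hk).1, (Finset.mem_sdiff.1 hk).2]
    · have := hM.law_misclassified_intersectionRule_le ha hb A k
      rwa [if_neg (Finset.mem_sdiff.1 hk).2] at this
  · rw [← mul_exp_neg_abs_log_add_log hK0 hβ0 hβ1]
    refine M.integral_card_div_le hδ A (S := fun D => A \ D) (U := fun D => Dᶜ)
      (Real.exp_pos _).le (fun D k hk => ?_) fun D k hk => ?_
    · simp [(Finset.mem_sdiff.1 hk).1, (Finset.mem_sdiff.1 hk).2]
    · have := hM.law_misclassified_intersectionRule_le ha hb A k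
      rwa [if_pos (Finset.mem_sdiff.1 hk).1] at this

/-- The exponential equals `n / min α β`, and levels of the same rate satisfy `max α β ≤ (1 + C) *
min α β`. This is where the restriction on the rates enters. -/
lemma exp_max_mul_max_le {n α β C : ℝ} (hn : 0 < n) (hC : 0 < C) (hα : α ∈ Ioo (0 : ℝ) 1)
    (hβ : β ∈ Ioo (0 : ℝ) 1) (h1 : C⁻¹ * α ≤ β) (h2 : β ≤ C * α) :
    Real.exp (max (|Real.log β| + Real.log n) (|Real.log α| + Real.log n)) * max α β ≤
      n * (1 + C) := by
  have key : ∀ x ∈ Ioo (0 : ℝ) 1, max α β ≤ (1 + C) * x →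
      Real.exp (|Real.log x| + Real.log n) * max α β ≤ n * (1 + C) := by
    intro x hx hle
    have hexp : Real.exp (|Real.log x| + Real.log n) = n / x := by
      rw [abs_of_neg (Real.log_neg hx.1 hx.2), Real.exp_add, Real.exp_log hn, Real.exp_neg,
        Real.exp_log hx.1]
      field_simp
    rw [hexp, div_mul_eq_mul_div, div_le_iff₀ hx.1, mul_assoc]
    exact mul_le_mul_of_nonneg_left hle hn.le
  have h1' : α ≤ C * β := by rwa [inv_mul_le_iff₀ hC] at h1
  have hCα := mul_pos hC hα.1
  have hCβ := mul_pos hC hβ.1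
  rcases max_cases (|Real.log β| + Real.log n) (|Real.log α| + Real.log n) with ⟨h, _⟩ | ⟨h, _⟩ <;>
    rw [h]
  · exact key β hβ (max_le (by linarith [hβ.1]) (by linarith))
  · exact key α hα (max_le (by linarith) (by linarith [hα.1]))

/-- The Intersection rule loses at most a constant, uniformly over levels of the same rate. -/
theorem LogLikelihoodCondition.ess_intersectionRule_le_minESS_add (hM : M.LogLikelihoodCondition)
    (hK : 0 < K) (A : Finset (Fin K)) {C : ℝ} (hC : 0 < C) {θ : ℝ × ℝ}
    (hθ : θ ∈ sameRateLevels C) :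
    M.ess A (M.intersectionRule (|Real.log θ.2| + Real.log K) (|Real.log θ.1| + Real.log K)) ≤
      M.minESS A (M.fdrClass θ) +
        ∑ k, (M.overhead A k + ENNReal.ofReal (2 * K * (K * (1 + C)))) := by
  obtain ⟨⟨hα, hβ⟩, h1, h2⟩ := hθ
  have hK0 : (0 : ℝ) < K := by exact_mod_cast hK
  have hmax : 0 ≤ max θ.1 θ.2 := hα.1.le.trans (le_max_left _ _)
  set a := |Real.log θ.2| + Real.log K
  set b := |Real.log θ.1| + Real.log K
  have ha : 0 ≤ a := add_nonneg (abs_nonneg _) (Real.log_natCast_nonneg K)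
  rw [minESS, ENNReal.iInf_add]
  refine le_iInf fun δ => ?_
  rw [ENNReal.iInf_add]
  refine le_iInf fun hδ => ?_
  refine (hM.ess_intersectionRule_le hδ.1 A (ha.trans (le_max_left a b)) (le_max_left a b)
    (le_max_right a b)).trans ?_
  gcongr with k
  calc _ ≤ ENNReal.ofReal (Real.exp (max a b)) *
        (ENNReal.ofReal (K * max θ.1 θ.2) + ENNReal.ofReal (K * max θ.1 θ.2)) := by
        gcongr <;> exact M.law_misclassified_le hδ _ k
    _ = ENNReal.ofReal (2 * K * (Real.exp (max a b) * max θ.1 θ.2)) := by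
        rw [← ENNReal.ofReal_add (by positivity) (by positivity),
          ← ENNReal.ofReal_mul (Real.exp_pos _).le]
        congr 1
        ring
    _ ≤ _ := by
        refine ENNReal.ofReal_le_ofReal (mul_le_mul_of_nonneg_left ?_ (by positivity))
        exact exp_max_mul_max_le hK0 hC hα hβ h1 h2

end StreamModel

theorem mainTheorem7 {K : ℕ} (hK : 2 ≤ K) {𝒳 : Fin K → Type*} [∀ k, MeasurableSpace (𝒳 k)]
    (M : StreamModel K 𝒳) (hM : M.LogLikelihoodCondition) (C : ℝ) (hC : 0 < C) :
    M.IsSecondOrderOptimal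
      (fun θ => M.intersectionRule (|Real.log θ.2| + Real.log K) (|Real.log θ.1| + Real.log K))
      M.fdrClass (sameRateLevels C) := by
  have hK0 : 0 < K := by omega
  refine ⟨fun θ hθ => hM.intersectionRule_mem_fdrClass hK0 hθ, fun A =>
    ⟨fun θ _ => hM.ess_intersectionRule_lt_top A _ _, ?_⟩⟩
  -- `R` does not depend on the levels, so the excess is bounded on all of `sameRateLevels C` and
  -- not only near `0`.
  set R : ℝ≥0∞ := ∑ k, (M.overhead A k + ENNReal.ofReal (2 * K * (K * (1 + C))))
  have hR : R < ⊤ := ENNReal.sum_lt_top.2 fun k _ =>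
    ENNReal.add_lt_top.2 ⟨hM.overhead_lt_top A k, ENNReal.ofReal_lt_top⟩
  refine lt_of_le_of_lt (limsup_le_of_le (a := (R : EReal)) (by isBoundedDefault) ?_)
    (lt_top_iff_ne_top.2 (EReal.coe_ennreal_eq_top_iff.not.2 hR.ne))
  filter_upwards [self_mem_nhdsWithin] with θ hθ
  refine EReal.sub_le_of_le_add' ?_
  rw [← EReal.coe_ennreal_add, EReal.coe_ennreal_le_coe_ennreal_iff]
  exact hM.ess_intersectionRule_le_minESS_add hK0 A hC hθ
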